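/- Let $f,g\in\mathbb{C}\{x,y\}$ be germs of holomorphic functions at the origin of $\mathbb{C}^2$. An *arc* is a fractional power series $\xi(y)$ of order $O_y(\xi)>0$. A *root* of $F\in\mathbb{C}\{x,y\}$ is an arc $\alpha$ with $F(\alpha(y),y)=0$; assume that all roots of $fg$ are simple. A *polar root* of $(f,g)$ is a root $\gamma$ of the Jacobian determinant $J=f_yg_x-f_xg_y$ with $f(\gamma(y),y)\,g(\gamma(y),y)\neq 0$. *Tree model.* The main trunk is the set of all roots of $fg$ (assumed non-empty). On top of each trunk $T$ (a set of roots) lies a bar $B$ of height $h(B)=\min_{\lambda,\mu\in T}O_y(\lambda-\mu)\in\mathbb{Q}\cup\{\infty\}$. If $h(B)<\infty$, then the trunks growing on $B$ are the classes of $T$ under the equivalence relation $O_y(\lambda-\mu)>h(B)$, and the construction is repeated. A trunk has bimultiplicity $[s,t]$ if it consists of $s$ roots of $f$ and $t$ roots of $g$. Let $B$ be a bar of finite height on top of a trunk $T$, and let $\lambda_B$ be any root in $T$ with all terms $y^e$, $e\ge h(B)$, omitted (it does not depend on the choice). An arc $\xi$ *climbs over* $B$ if $\xi=\lambda_B+a\,y^{h(B)}+\cdots$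 for some $a\in\mathbb{C}$, where $\cdots$ stands for terms of higher order. For $F=f,g$ let $\nu_F(B)=O_y\big(F(\lambda_B(y)+z\,y^{h(B)},y)\big)$ for generic $z\in\mathbb{C}$. Let $T_1,\dots,T_l$ be the trunks growing on $B$, where $T_k$ has bimultiplicity $[p_k,q_k]$ and consists of roots of the form $\lambda_B+z_ky^{h(B)}+\cdots$. Put $$\Delta_B(z_k)=\nu_f(B)\,q_k-\nu_g(B)\,p_k,\qquad \mathscr M_B(z)=\sum_{k=1}^l\frac{\Delta_B(z_k)}{z-z_k}.$$ The point $z_k$ is *collinear* if $\Delta_B(z_k)=0$ and *non-collinear* otherwise; $n(B)$ is the number of non-collinear points, $m(B)$ is the number of zeros of the rational function $\mathscr M_B$ in $\mathbb{C}$ counted with multiplicities, and $B$ is *purely non-collinear* if there is no collinear point and at least one non-collinear point. **Corollary.** Let $B$ be a bar of finite height on top of a trunk of bimultiplicity $[s,0]$ with $\nu_g(B)\neq 0$ (resp. of bimultiplicity $[0,t]$ with $\nu_f(B)\neq0$). Then $B$ is purely non-collinear, $m(B)+1=n(B)$, and exactly $s-1$ (resp. $t-1$) polar roots, counted with multiplicities,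 climb over $B$. -/

import Mathlib

open MvPowerSeries

noncomputable section

namespace PolarTree

/-- Formal power series in two variables over the complex numbers;
variable `0` is `x` and variable `1` is `y`. -/
abbrev Series2 : Type := MvPowerSeries (Fin 2) ℂ

/-- `F` is a germ of a holomorphic function at the origin, i.e. `F` lies in `ℂ{x, y}`: the
series converges absolutely on some polydisc of positive radius. -/
def IsConvergent (F : Series2) : Prop :=
  ∃ r : ℝ, 0 < r ∧ Summable fun n : Fin 2 →₀ ℕ => ‖coeff n F‖ * r ^ n.degree

/-- Generalized power series in `y` with rational exponents and well-ordered support. The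
fractional power series are singled out among them by `IsArc`. The order `O_y` is
`HahnSeries.orderTop`, with value `⊤` at `0`. -/
abbrev QSeries : Type := HahnSeries ℚ ℂ

/-- The monomial `c y ^ e`. -/
abbrev mono (e : ℚ) (c : ℂ) : QSeries := HahnSeries.single e c

/-- An arc of positive order: a fractional power series (all exponents are multiples of `1 / D`,
for some positive integer `D`) with only positive exponents. -/
def IsArc (ξ : QSeries) : Prop :=
  ∃ D : ℕ, 0 < D ∧ ∀ e ∈ ξ.support, ∃ n : ℕ, 0 < n ∧ e = (n : ℚ) / D

/-- The series `F(ξ(y), y) = ∑ F_{ij} ξ(y)^i y^j`, for `ξ` of positive order. -/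
def evalAt (F : Series2) (ξ : QSeries) : QSeries :=
  (HahnSeries.SummableFamily.smulFamily
    (fun p : ℕ × ℕ => coeff (Finsupp.single 0 p.1 + Finsupp.single 1 p.2) F)
    ((HahnSeries.SummableFamily.powers ξ).mul
      (HahnSeries.SummableFamily.powers (mono 1 1)))).hsum

/-- The Newton-Puiseux roots `x = α(y)`, `O_y(α) > 0`, of `F(x, y)`. -/
def roots (F : Series2) : Set QSeries := {α | IsArc α ∧ evalAt F α = 0}

/-- The multiplicity of the arc `α` as a root of `F(x, y)`: the least `k` such that
`∂ᵏF/∂xᵏ` does not vanish along `α`. It is `⊤` if there is no such `k`. -/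
def rootMult (F : Series2) (α : QSeries) : ℕ∞ :=
  ⨅ k ∈ {k : ℕ | evalAt ((fun G => pderiv ℂ 0 G)^[k] F) α ≠ 0}, (k : ℕ∞)

/-- All Newton-Puiseux roots of `F` are simple. -/
def HasSimpleRoots (F : Series2) : Prop := ∀ α ∈ roots F, rootMult F α = 1

/-- The Jacobian determinant `f_y g_x - f_x g_y`. -/
def jacobian (f g : Series2) : Series2 :=
  pderiv ℂ 1 f * pderiv ℂ 0 g - pderiv ℂ 0 f * pderiv ℂ 1 g

/-- A polar root of `(f, g)`: a Newton-Puiseux root of the Jacobian determinant which is a root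
neither of `f` nor of `g`. -/
def IsPolarRoot (f g : Series2) (γ : QSeries) : Prop :=
  γ ∈ roots (jacobian f g) ∧ evalAt f γ * evalAt g γ ≠ 0

/-- The contact order `O(ξ, η) = O_y(ξ - η)`. -/
def contact (ξ η : QSeries) : WithTop ℚ := (ξ - η).orderTop

/-- `h` is the height of the bar on top of the trunk consisting of the roots in `T`: the
smallest contact order of two (possibly equal) members of `T`. -/
def IsTopHeight (T : Set QSeries) (h : WithTop ℚ) : Prop :=
  IsLeast {o | ∃ μ ∈ T, ∃ η ∈ T, o = contact μ η} h

/-- The trunks of the tree model of a set `Λ` of arcs, each trunk being identified with the set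
of roots bundled together in it. The main trunk carries all of `Λ`. If the bar on top of a trunk
`T` has finite height `h`, the trunks growing on this bar are the equivalence classes of `T`
modulo `h⁺`. -/
inductive IsTrunk (Λ : Set QSeries) : Set QSeries → Prop
  | main : Λ.Nonempty → IsTrunk Λ Λ
  | grow {T : Set QSeries} {h : ℚ} {μ : QSeries} :
      IsTrunk Λ T → IsTopHeight T h → μ ∈ T → IsTrunk Λ {η ∈ T | (h : WithTop ℚ) < contact μ η}

theorem IsTrunk.nonempty {Λ T : Set QSeries} (hT : IsTrunk Λ T) : T.Nonempty := by
  induction hT with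
  | main h => exact h
  | @grow T h μ _ _ hμ _ => exact ⟨μ, hμ, by simp [contact]⟩

/-- A bar of finite height of the tree model `T(f, g)`, other than the ground bar: it is given by
the trunk on top of which it lies, and its height. -/
structure Bar (f g : Series2) where
  /-- the trunk on top of which the bar lies -/
  trunk : Set QSeries
  isTrunk : IsTrunk (roots f ∪ roots g) trunk
  /-- the height `h(B)` -/
  height : ℚ
  isTopHeight : IsTopHeight trunk height

/-- A set `T` of roots of `f g` has bimultiplicity `[s, t]`: it contains `s` roots of `f` and `t`
roots of `g`. -/
def HasBimult (f g : Series2) (T : Set QSeries) (s t : ℕ) : Prop :=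
  (T ∩ roots f).encard = s ∧ (T ∩ roots g).encard = t

namespace Bar

variable {f g : Series2} (B : Bar f g)

/-- The arc `λ_B`: any root of the trunk below `B`, with all terms `y ^ e`, `e ≥ h(B)`,
omitted. -/
def base : QSeries := HahnSeries.truncLT B.height B.isTrunk.nonempty.some

/-- `λ_B` does not depend on the chosen root. -/
theorem base_eq {μ : QSeries} (hμ : μ ∈ B.trunk) :
    B.base = HahnSeries.truncLT B.height μ := by
  have hle : (B.height : WithTop ℚ) ≤ contact B.isTrunk.nonempty.some μ :=
    B.isTopHeight.2 ⟨_, B.isTrunk.nonempty.some_mem, _, hμ, rfl⟩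
  ext e
  simp only [base, HahnSeries.coeff_truncLT]
  split_ifs with he
  · have := HahnSeries.coeff_eq_zero_of_lt_orderTop
      (lt_of_lt_of_le (WithTop.coe_lt_coe.2 he) hle)
    rwa [HahnSeries.coeff_sub, sub_eq_zero] at this
  · rfl

/-- The roots `λ_B + c y ^ h(B) + ⋯` of the trunk below `B`: if there are any, they form the
trunk growing on `B` at `c`. -/
def trunkAt (c : ℂ) : Set QSeries := {μ ∈ B.trunk | μ.coeff B.height = c}

/-- The set `{z_1, …, z_l}` of points of `B` at which trunks grow. -/
def points : Set ℂ := {c | (B.trunkAt c).Nonempty}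

/-- The trunk growing on `B` which contains `μ` is the class of `μ` modulo `h(B)⁺`. -/
theorem trunkAt_coeff {μ : QSeries} (hμ : μ ∈ B.trunk) :
    B.trunkAt (μ.coeff B.height) = {η ∈ B.trunk | (B.height : WithTop ℚ) < contact μ η} := by
  ext η
  simp only [trunkAt, Set.mem_ofPred_eq, and_congr_right_iff]
  intro hη
  have hle : (B.height : WithTop ℚ) ≤ contact μ η := B.isTopHeight.2 ⟨_, hμ, _, hη, rfl⟩
  constructor
  · intro h
    refine lt_of_le_of_ne hle fun he => ?_
    have hne : μ - η ≠ 0 := by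
      intro h0
      simp [contact, h0] at he
    have := HahnSeries.coeff_orderTop_ne (x := μ - η) he.symm
    simp [h] at this
  · intro h
    have := HahnSeries.coeff_eq_zero_of_lt_orderTop h
    rw [HahnSeries.coeff_sub, sub_eq_zero] at this
    exact this.symm

open scoped Classical in
/-- `ν_F(B)`: the order in `y` of `F(λ_B(y) + z y ^ h(B), y)` for generic `z`, that is, for all
but finitely many `z`. (It exists for every `F ≠ 0`; the default value is `0`.) -/
def nu (F : Series2) : ℚ :=
  if h : ∃ e : ℚ, ∀ᶠ z : ℂ in Filter.cofinite,
      (evalAt F (B.base + mono B.height z)).orderTop = e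
  then h.choose else 0

/-- The number of roots of `f` in the trunk growing at `c`. -/
def p (c : ℂ) : ℕ := (B.trunkAt c ∩ roots f).ncard

/-- The number of roots of `g` in the trunk growing at `c`. -/
def q (c : ℂ) : ℕ := (B.trunkAt c ∩ roots g).ncard

/-- `Δ_B(c) = ν_f(B) q(c) - p(c) ν_g(B)`. -/
def delta (c : ℂ) : ℚ := Matrix.det !![B.nu f, (B.p c : ℚ); B.nu g, (B.q c : ℚ)]

/-- The set `C(B)` of collinear points. -/
def collinearPoints : Set ℂ := {c ∈ B.points | B.delta c = 0}

/-- The set `N(B)` of non-collinear points. -/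
def nonCollinearPoints : Set ℂ := {c ∈ B.points | B.delta c ≠ 0}

/-- `n(B)`, the number of non-collinear points. -/
def n : ℕ := B.nonCollinearPoints.ncard

/-- `B` is purely non-collinear: `C(B) = ∅ ≠ N(B)`. -/
def IsPurelyNonCollinear : Prop := B.collinearPoints = ∅ ∧ B.nonCollinearPoints ≠ ∅

/-- The rational function `∑ₖ Δ_B(z_k) / (z - z_k)` associated to `B`. -/
def ratFunc : RatFunc ℂ :=
  ∑ᶠ c ∈ B.points, RatFunc.C (B.delta c : ℂ) / (RatFunc.X - RatFunc.C c)

/-- The set `M(B)` of mero-zeros: the zeros of the rational function of `B`, i.e. of its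
numerator in lowest terms. -/
def meroZeros : Set ℂ := {z | B.ratFunc.num.IsRoot z}

/-- The multiplicity `m_B(z)` of a mero-zero (when the rational function is not identically
zero). -/
def meroMult (z : ℂ) : ℕ := B.ratFunc.num.rootMultiplicity z

/-- `m(B)`, the number of mero-zeros counted with multiplicities. -/
def m : ℕ := ∑ᶠ z ∈ B.meroZeros, B.meroMult z

/-- `ξ = λ_B + a y ^ h(B) + ⋯`: the arc `ξ` climbs over `B` at `a`. -/
def ClimbsAt (ξ : QSeries) (a : ℂ) : Prop :=
  (B.height : WithTop ℚ) < (ξ - (B.base + mono B.height a)).orderTop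

/-- The arc `ξ` climbs over `B`. -/
def Climbs (ξ : QSeries) : Prop := ∃ a : ℂ, B.ClimbsAt ξ a

/-- The total number of polar roots which climb over `B`, counted with multiplicities: a polar
root `γ` of multiplicity `k` contributes the `k` pairs `(γ, 0), …, (γ, k - 1)`. -/
def polarCount : ℕ∞ :=
  {w : QSeries × ℕ | IsPolarRoot f g w.1 ∧ B.Climbs w.1 ∧
    (w.2 : ℕ∞) < rootMult (jacobian f g) w.1}.encard

end Bar

end PolarTree

end

/-! Write h for the height of B, and consider the arcs ξ = λ_B + a y^h + ⋯ climbing over B. For each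
nonzero germ F there are an exponent ν = ν_F(B) and a polynomial P_F ≠ 0 with F(ξ) = P_F(a) y^ν + ⋯
and F_x(ξ) = P_F'(a) y^(ν-h) + ⋯, and deg P_F is the number of roots of F, with multiplicity, that
climb over B (`HasRootMultiset.exists_initialForm`). This follows by factoring F into a power of y,
a unit and linear factors x - α, using Weierstrass preparation and the Newton-Puiseux theorem
(`exists_hasRootMultiset`, `puiseuxSplits_of_monic`).

By the chain rule, y J(ξ) = (y d/dy f(ξ)) g_x(ξ) - (y d/dy g(ξ)) f_x(ξ), so J(ξ) has the coefficient
ν_f P_f P_g' - ν_g P_g P_f' at the exponent ν_f + ν_g - h - 1 (`HasLeadingTerm.evalAt_jacobian`).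
Over a trunk [s, 0] the polynomial P_g is a nonzero constant b and P_f has degree s, so this
coefficient is -ν_g b P_f', a polynomial of degree s - 1 when ν_g ≠ 0. It must be the initial form
of J, hence s - 1 roots of J climb over B. Each is polar: g cannot vanish there because b ≠ 0, and
f(γ) = 0 would force f_x(γ) = 0, against simplicity (`Bar.polarCount_add_one`).

For the rational function, Δ_B(z_k) = -ν_g p_k with every p_k > 0. No residue vanishes and neither
does their sum, so the numerator in lowest terms has degree l - 1
(`natDegree_num_sum_simple_fractions`, `Bar.m_add_one_eq`). The case [0, t] is symmetric. -/

namespace PolarTree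

/-! ### Leading terms of Hahn series -/

/-- `ξ = c y ^ e + ⋯`, where the coefficient `c` may vanish. -/
def HasLeadingTerm (ξ : QSeries) (e : ℚ) (c : ℂ) : Prop :=
  (e : WithTop ℚ) < (ξ - mono e c).orderTop

theorem hasLeadingTerm_iff {ξ : QSeries} {e : ℚ} {c : ℂ} :
    HasLeadingTerm ξ e c ↔ (e : WithTop ℚ) ≤ ξ.orderTop ∧ ξ.coeff e = c := by
  constructor
  · intro h
    have h1 : ξ = (ξ - mono e c) + mono e c := by ring
    refine ⟨?_, ?_⟩
    · rw [h1]
      exact le_trans (le_min h.le HahnSeries.orderTop_single_le)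
        HahnSeries.min_orderTop_le_orderTop_add
    · have := HahnSeries.coeff_eq_zero_of_lt_orderTop h
      simpa [sub_eq_zero] using this
  · rintro ⟨h1, h2⟩
    have hle : (e : WithTop ℚ) ≤ (ξ - mono e c).orderTop :=
      le_trans (le_min h1 HahnSeries.orderTop_single_le) HahnSeries.min_orderTop_le_orderTop_sub
    refine lt_of_le_of_ne hle fun he => ?_
    exact HahnSeries.coeff_orderTop_ne he.symm (by simp [h2])

theorem HasLeadingTerm.le {ξ : QSeries} {e : ℚ} {c : ℂ} (h : HasLeadingTerm ξ e c) :
    (e : WithTop ℚ) ≤ ξ.orderTop := (hasLeadingTerm_iff.1 h).1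

theorem HasLeadingTerm.coeff {ξ : QSeries} {e : ℚ} {c : ℂ} (h : HasLeadingTerm ξ e c) :
    ξ.coeff e = c := (hasLeadingTerm_iff.1 h).2

theorem HasLeadingTerm.orderTop_eq {ξ : QSeries} {e : ℚ} {c : ℂ} (h : HasLeadingTerm ξ e c)
    (hc : c ≠ 0) : ξ.orderTop = e :=
  le_antisymm (HahnSeries.orderTop_le_of_coeff_ne_zero (by rwa [h.coeff])) h.le

theorem HasLeadingTerm.ne_zero {ξ : QSeries} {e : ℚ} {c : ℂ} (h : HasLeadingTerm ξ e c)
    (hc : c ≠ 0) : ξ ≠ 0 := by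
  rintro rfl
  simpa using h.orderTop_eq hc

theorem hasLeadingTerm_mono (e : ℚ) (c : ℂ) : HasLeadingTerm (mono e c) e c := by
  simp [HasLeadingTerm]

theorem hasLeadingTerm_of_lt {ξ : QSeries} {e : ℚ} (h : (e : WithTop ℚ) < ξ.orderTop) :
    HasLeadingTerm ξ e 0 := by simpa [HasLeadingTerm] using h

theorem hasLeadingTerm_zero (e : ℚ) : HasLeadingTerm 0 e 0 := by
  simpa using hasLeadingTerm_mono e 0

theorem hasLeadingTerm_of_ne_zero {ξ : QSeries} (h : ξ ≠ 0) :
    ∃ (e : ℚ) (c : ℂ), c ≠ 0 ∧ ξ.orderTop = e ∧ HasLeadingTerm ξ e c := by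
  obtain ⟨e, he⟩ := WithTop.ne_top_iff_exists.1 (HahnSeries.orderTop_ne_top.2 h)
  exact ⟨e, ξ.coeff e, HahnSeries.coeff_orderTop_ne he.symm, he.symm,
    hasLeadingTerm_iff.2 ⟨he.le, rfl⟩⟩

theorem HasLeadingTerm.add {ξ η : QSeries} {e : ℚ} {c d : ℂ} (h : HasLeadingTerm ξ e c)
    (h' : HasLeadingTerm η e d) : HasLeadingTerm (ξ + η) e (c + d) :=
  hasLeadingTerm_iff.2 ⟨le_trans (le_min h.le h'.le) HahnSeries.min_orderTop_le_orderTop_add,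
    by simp [h.coeff, h'.coeff]⟩

theorem HasLeadingTerm.neg {ξ : QSeries} {e : ℚ} {c : ℂ} (h : HasLeadingTerm ξ e c) :
    HasLeadingTerm (-ξ) e (-c) :=
  hasLeadingTerm_iff.2 ⟨by simpa using h.le, by simp [h.coeff]⟩

theorem HasLeadingTerm.sub {ξ η : QSeries} {e : ℚ} {c d : ℂ} (h : HasLeadingTerm ξ e c)
    (h' : HasLeadingTerm η e d) : HasLeadingTerm (ξ - η) e (c - d) := by
  simpa [sub_eq_add_neg] using h.add h'.neg

theorem HasLeadingTerm.mul {ξ η : QSeries} {e e' : ℚ} {c d : ℂ} (h : HasLeadingTerm ξ e c)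
    (h' : HasLeadingTerm η e' d) : HasLeadingTerm (ξ * η) (e + e') (c * d) := by
  have hlt : ∀ {a b : WithTop ℚ} {p q : ℚ}, (p : WithTop ℚ) < a → (q : WithTop ℚ) ≤ b →
      ((p + q : ℚ) : WithTop ℚ) < a + b := by
    intro a b p q hp hq
    induction a with
    | top => simp
    | coe a =>
      induction b with
      | top => simp
      | coe b => norm_cast at *; exact add_lt_add_of_lt_of_le hp hq
  have h1 : ξ * η - mono (e + e') (c * d) =
      (ξ - mono e c) * η + (η - mono e' d) * mono e c := by
    have : mono (e + e') (c * d) = mono e c * mono e' d := by simp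
    rw [this]; ring
  rw [HasLeadingTerm, h1]
  refine lt_of_lt_of_le (lt_min ?_ ?_) HahnSeries.min_orderTop_le_orderTop_add
  · rw [HahnSeries.orderTop_mul]
    exact hlt h h'.le
  · rw [HahnSeries.orderTop_mul, add_comm e]
    exact hlt h' HahnSeries.orderTop_single_le

theorem HasLeadingTerm.congr {ξ η : QSeries} {e : ℚ} {c : ℂ} (h : HasLeadingTerm η e c)
    (h' : (e : WithTop ℚ) < (ξ - η).orderTop) : HasLeadingTerm ξ e c := by
  simpa using (hasLeadingTerm_of_lt h').add h

theorem HasLeadingTerm.zero_of_lt {ξ : QSeries} {e e' : ℚ} {c : ℂ} (h : HasLeadingTerm ξ e c)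
    (he : e' < e) : HasLeadingTerm ξ e' 0 :=
  hasLeadingTerm_of_lt (lt_of_lt_of_le (WithTop.coe_lt_coe.2 he) h.le)

/-! ### The Euler derivation `y d/dy` -/

/-- The Euler derivation `y d/dy`. -/
def euler (ξ : QSeries) : QSeries where
  coeff e := (e : ℂ) * ξ.coeff e
  isPWO_support' := ξ.isPWO_support.mono fun e he h => he (by simp [h])

@[simp]
theorem coeff_euler (ξ : QSeries) (e : ℚ) : (euler ξ).coeff e = (e : ℂ) * ξ.coeff e := rfl

theorem support_euler_subset (ξ : QSeries) : (euler ξ).support ⊆ ξ.support :=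
  fun e he h => he (by simp [h])

theorem euler_add (ξ η : QSeries) : euler (ξ + η) = euler ξ + euler η := by
  ext e; simp [mul_add]

@[simp]
theorem euler_zero : euler 0 = 0 := by ext e; simp

theorem euler_mono (e : ℚ) (c : ℂ) : euler (mono e c) = mono e (e * c) := by
  ext e'
  by_cases h : e' = e
  · subst h; simp
  · simp [HahnSeries.coeff_single_of_ne h]

theorem euler_mul (ξ η : QSeries) : euler (ξ * η) = euler ξ * η + ξ * euler η := by
  ext e
  -- All three products are summed over the pairs in the supports of ξ and η, so that they can be
  -- compared term by term.
  rw [HahnSeries.coeff_add, coeff_euler, HahnSeries.coeff_mul,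
    HahnSeries.coeff_mul_left' ξ.isPWO_support (support_euler_subset ξ),
    HahnSeries.coeff_mul_right' η.isPWO_support (support_euler_subset η), Finset.mul_sum,
    ← Finset.sum_add_distrib]
  refine Finset.sum_congr rfl fun p hp => ?_
  have : p.1 + p.2 = e := by simp at hp; exact hp.2.2
  subst this
  simp only [coeff_euler]
  push_cast
  ring

/-- Only an inequality, because the constant term is killed; this is why the condition ν ≠ 0 matters
later. -/
theorem orderTop_le_orderTop_euler (ξ : QSeries) : ξ.orderTop ≤ (euler ξ).orderTop := by
  rw [HahnSeries.le_orderTop_iff_forall]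
  intro e he
  simp [HahnSeries.coeff_eq_zero_of_lt_orderTop he]

theorem HasLeadingTerm.euler {ξ : QSeries} {e : ℚ} {c : ℂ} (h : HasLeadingTerm ξ e c) :
    HasLeadingTerm (euler ξ) e (e * c) :=
  hasLeadingTerm_iff.2 ⟨h.le.trans (orderTop_le_orderTop_euler ξ), by simp [h.coeff]⟩

/-- A Hahn series of arbitrarily large order vanishes. -/
theorem eq_zero_of_forall_le_orderTop {ξ : QSeries} {ω : ℚ} (hω : 0 < ω)
    (h : ∀ N : ℕ, ((N * ω : ℚ) : WithTop ℚ) ≤ ξ.orderTop) : ξ = 0 := by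
  by_contra hξ
  obtain ⟨e, -, -, he, -⟩ := hasLeadingTerm_of_ne_zero hξ
  obtain ⟨N, hN⟩ := exists_nat_gt (e / ω)
  have := h N
  rw [he, WithTop.coe_le_coe] at this
  rw [div_lt_iff₀ hω] at hN
  linarith

/-! ### Evaluation of power series in two variables -/

/-- The series `F(ξ, η) = ∑ F_{ij} ξ ^ i η ^ j`, for `ξ` and `η` of positive order. -/
noncomputable def evalPair (ξ η : QSeries) (F : Series2) : QSeries :=
  (HahnSeries.SummableFamily.smulFamily
    (fun p : ℕ × ℕ => coeff (Finsupp.single 0 p.1 + Finsupp.single 1 p.2) F)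
    ((HahnSeries.SummableFamily.powers ξ).mul (HahnSeries.SummableFamily.powers η))).hsum

theorem evalAt_eq_evalPair (F : Series2) (ξ : QSeries) :
    evalAt F ξ = evalPair ξ (mono 1 1) F := rfl

theorem orderTop_mono_one_pos : 0 < (mono 1 1).orderTop := by
  rw [HahnSeries.orderTop_single one_ne_zero]; exact_mod_cast one_pos

section evalPair

variable {ξ η : QSeries}

theorem evalPair_add (F G : Series2) : evalPair ξ η (F + G) = evalPair ξ η F + evalPair ξ η G := by
  simp only [evalPair]
  rw [← HahnSeries.SummableFamily.hsum_add]
  congr 1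
  ext1 p
  simp only [HahnSeries.SummableFamily.smulFamily_toFun, HahnSeries.SummableFamily.add_apply,
    map_add, add_smul]

theorem evalPair_smul (c : ℂ) (F : Series2) : evalPair ξ η (c • F) = c • evalPair ξ η F := by
  ext e
  simp only [evalPair, HahnSeries.SummableFamily.coeff_hsum, HahnSeries.coeff_smul]
  rw [smul_finsum]
  simp only [HahnSeries.SummableFamily.smulFamily_toFun, HahnSeries.coeff_smul, map_smul,
    smul_eq_mul, mul_assoc]

/-- Evaluation at `(ξ, η)` as a linear map. -/
noncomputable def evalLinear (ξ η : QSeries) : Series2 →ₗ[ℂ] QSeries where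
  toFun := evalPair ξ η
  map_add' := evalPair_add
  map_smul' := evalPair_smul

theorem evalPair_sub (F G : Series2) : evalPair ξ η (F - G) = evalPair ξ η F - evalPair ξ η G :=
  map_sub (evalLinear ξ η) F G

theorem le_orderTop_pow {ξ : QSeries} {ω : ℚ} (h : (ω : WithTop ℚ) ≤ ξ.orderTop) (n : ℕ) :
    ((n * ω : ℚ) : WithTop ℚ) ≤ (ξ ^ n).orderTop := by
  refine le_trans ?_ HahnSeries.orderTop_nsmul_le_orderTop_pow
  rw [← nsmul_eq_mul, WithTop.coe_nsmul]
  exact nsmul_le_nsmul_right h n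

variable (hξ : 0 < ξ.orderTop) (hη : 0 < η.orderTop)
include hξ hη

/-- The family `powers ξ` is known to consist of the powers of ξ when ξ has positive order, hence
the positivity hypotheses from here on. -/
theorem coeff_evalPair (F : Series2) (e : ℚ) :
    (evalPair ξ η F).coeff e = ∑ᶠ p : ℕ × ℕ,
      coeff (Finsupp.single 0 p.1 + Finsupp.single 1 p.2) F * (ξ ^ p.1 * η ^ p.2).coeff e := by
  simp only [evalPair, HahnSeries.SummableFamily.coeff_hsum]
  refine finsum_congr fun p => ?_
  simp [HahnSeries.SummableFamily.powers_of_orderTop_pos hξ,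
    HahnSeries.SummableFamily.powers_of_orderTop_pos hη]

/-- Continuity of evaluation: identities valid for polynomials pass to power series, since
truncation errors get arbitrarily large order. -/
theorem le_orderTop_evalPair {ω : ℚ} (hωξ : (ω : WithTop ℚ) ≤ ξ.orderTop)
    (hωη : (ω : WithTop ℚ) ≤ η.orderTop) (hω : 0 ≤ ω) {F : Series2} {M : ℕ}
    (hF : ∀ n : Fin 2 →₀ ℕ, n.degree < M → coeff n F = 0) :
    ((M * ω : ℚ) : WithTop ℚ) ≤ (evalPair ξ η F).orderTop := by
  rw [HahnSeries.le_orderTop_iff_forall]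
  intro e he
  rw [coeff_evalPair hξ hη]
  refine finsum_eq_zero_of_forall_eq_zero fun p => ?_
  by_cases hp : p.1 + p.2 < M
  · rw [hF _ (by simpa using hp), zero_mul]
  · rw [HahnSeries.coeff_eq_zero_of_lt_orderTop, mul_zero]
    refine lt_of_lt_of_le he ?_
    rw [HahnSeries.orderTop_mul]
    refine le_trans ?_ (add_le_add (le_orderTop_pow hωξ p.1) (le_orderTop_pow hωη p.2))
    norm_cast
    rw [← add_mul]
    have : (M : ℚ) ≤ p.1 + p.2 := by exact_mod_cast not_lt.1 hp
    exact mul_le_mul_of_nonneg_right this hω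

theorem evalPair_monomial (n : Fin 2 →₀ ℕ) (c : ℂ) :
    evalPair ξ η (monomial n c) = c • (ξ ^ n 0 * η ^ n 1) := by
  have hn : ∀ p : ℕ × ℕ, Finsupp.single 0 p.1 + Finsupp.single 1 p.2 = n ↔ p = (n 0, n 1) := by
    intro p
    constructor
    · rintro rfl; simp
    · rintro rfl; ext i; fin_cases i <;> simp
  ext e
  rw [coeff_evalPair hξ hη, finsum_eq_single _ (n 0, n 1)]
  · rw [(hn _).2 rfl, coeff_monomial_same]; simp
  · intro p hp
    rw [coeff_monomial_ne (fun h => hp ((hn p).1 h)), zero_mul]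

theorem evalPair_coe (P : MvPolynomial (Fin 2) ℂ) :
    evalPair ξ η (P : Series2) = MvPolynomial.eval₂Hom HahnSeries.C ![ξ, η] P := by
  induction P using MvPolynomial.induction_on' with
  | monomial n c =>
    rw [MvPolynomial.coe_monomial, evalPair_monomial hξ hη, MvPolynomial.eval₂Hom_monomial,
      Finsupp.prod_fintype _ _ (by simp), HahnSeries.C_mul_eq_smul]
    simp
  | add P Q hP hQ => rw [MvPolynomial.coe_add, evalPair_add, hP, hQ, map_add]

theorem evalPair_C (c : ℂ) : evalPair ξ η (C c) = mono 0 c := by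
  rw [← MvPolynomial.coe_C, evalPair_coe hξ hη, MvPolynomial.eval₂Hom_C, HahnSeries.C_apply]

omit hξ hη in
theorem exists_pos_le_orderTop (hξ : 0 < ξ.orderTop) (hη : 0 < η.orderTop) :
    ∃ ω : ℚ, 0 < ω ∧ (ω : WithTop ℚ) ≤ ξ.orderTop ∧ (ω : WithTop ℚ) ≤ η.orderTop := by
  have key : ∀ a : WithTop ℚ, 0 < a → ∃ r : ℚ, 0 < r ∧ (r : WithTop ℚ) ≤ a := by
    intro a ha
    induction a with
    | top => exact ⟨1, one_pos, le_top⟩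
    | coe a => exact ⟨a, by exact_mod_cast ha, le_rfl⟩
  obtain ⟨ω, h0, h⟩ := key _ (lt_min hξ hη)
  exact ⟨ω, h0, h.trans (min_le_left _ _), h.trans (min_le_right _ _)⟩

omit hξ hη in
theorem coeff_sub_truncTotal (F : Series2) {M : ℕ} {n : Fin 2 →₀ ℕ} (hn : n.degree < M) :
    coeff n (F - (truncTotal M F : Series2)) = 0 := by
  simp [MvPolynomial.coeff_coe, coeff_truncTotal _ hn]

/-- On polynomials evaluation is `eval₂Hom`. Truncating both factors at total degree M costs an
error of order at least M ω, for every M. -/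
theorem evalPair_mul (F G : Series2) : evalPair ξ η (F * G) = evalPair ξ η F * evalPair ξ η G := by
  obtain ⟨ω, hω, h1, h2⟩ := exists_pos_le_orderTop hξ hη
  rw [← sub_eq_zero]
  refine eq_zero_of_forall_le_orderTop hω fun M => ?_
  set P := truncTotal M F
  set Q := truncTotal M G
  have hF := fun n hn => coeff_sub_truncTotal F (M := M) (n := n) hn
  have hG := fun n hn => coeff_sub_truncTotal G (M := M) (n := n) hn
  have hmul : ∀ A B : Series2, (∀ n : Fin 2 →₀ ℕ, n.degree < M → coeff n A = 0) →
      ∀ n : Fin 2 →₀ ℕ, n.degree < M → coeff n (A * B) = 0 := by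
    intro A B hA n hn
    rw [coeff_mul]
    refine Finset.sum_eq_zero fun p hp => ?_
    rw [hA, zero_mul]
    have := Finset.HasAntidiagonal.mem_antidiagonal.1 hp
    rw [← this, map_add] at hn
    omega
  have hPQ : evalPair ξ η ((P : Series2) * Q) = evalPair ξ η P * evalPair ξ η Q := by
    rw [← MvPolynomial.coe_mul, evalPair_coe hξ hη, map_mul, evalPair_coe hξ hη,
      evalPair_coe hξ hη]
  have e1 : F * G = P * Q + ((F - P) * G + (G - Q) * P) := by ring
  have e2 : evalPair ξ η F = evalPair ξ η P + evalPair ξ η (F - P) := by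
    rw [← evalPair_add]; congr 1; ring
  have e3 : evalPair ξ η G = evalPair ξ η Q + evalPair ξ η (G - Q) := by
    rw [← evalPair_add]; congr 1; ring
  have e4 : evalPair ξ η (F * G) - evalPair ξ η F * evalPair ξ η G =
      evalPair ξ η ((F - P) * G + (G - Q) * P) -
      (evalPair ξ η (F - P) * evalPair ξ η G + evalPair ξ η (G - Q) * evalPair ξ η P) := by
    rw [e1, evalPair_add, hPQ, e2, e3]; ring
  have hnn : ∀ A : Series2, (0 : WithTop ℚ) ≤ (evalPair ξ η A).orderTop := by
    intro A
    simpa using le_orderTop_evalPair hξ hη h1 h2 hω.le (F := A) (M := 0) (by simp)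
  have hm : ∀ A B : Series2, (∀ n : Fin 2 →₀ ℕ, n.degree < M → coeff n A = 0) →
      ((M * ω : ℚ) : WithTop ℚ) ≤ (evalPair ξ η A * evalPair ξ η B).orderTop := by
    intro A B hA
    rw [HahnSeries.orderTop_mul]
    simpa using add_le_add (le_orderTop_evalPair hξ hη h1 h2 hω.le hA) (hnn B)
  rw [e4]
  refine le_trans (le_min ?_ ?_) HahnSeries.min_orderTop_le_orderTop_sub
  · refine le_orderTop_evalPair hξ hη h1 h2 hω.le fun n hn => ?_
    rw [map_add, hmul _ _ hF n hn, hmul _ _ hG n hn, add_zero]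
  · exact le_trans (le_min (hm _ _ hF) (hm _ _ hG)) HahnSeries.min_orderTop_le_orderTop_add

/-- Evaluation at a pair of Hahn series of positive order, as a ring homomorphism. -/
noncomputable def evalHom : Series2 →+* QSeries where
  toFun := evalPair ξ η
  map_zero' := map_zero (evalLinear ξ η)
  map_one' := by
    have := evalPair_coe hξ hη 1
    rwa [MvPolynomial.coe_one, map_one] at this
  map_add' := evalPair_add
  map_mul' := evalPair_mul hξ hη

theorem evalPair_X_zero : evalPair ξ η (X 0) = ξ := by
  rw [← MvPolynomial.coe_X, evalPair_coe hξ hη]; simp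

theorem evalPair_X_one : evalPair ξ η (X 1) = η := by
  rw [← MvPolynomial.coe_X, evalPair_coe hξ hη]; simp

theorem orderTop_evalPair_nonneg (F : Series2) : 0 ≤ (evalPair ξ η F).orderTop := by
  obtain ⟨ω, hω, h1, h2⟩ := exists_pos_le_orderTop hξ hη
  simpa using le_orderTop_evalPair hξ hη h1 h2 hω.le (F := F) (M := 0) (by simp)

theorem hasLeadingTerm_evalPair (F : Series2) :
    HasLeadingTerm (evalPair ξ η F) 0 (constantCoeff F) := by
  obtain ⟨ω, hω, h1, h2⟩ := exists_pos_le_orderTop hξ hη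
  have h := le_orderTop_evalPair hξ hη h1 h2 hω.le (F := F - C (constantCoeff F)) (M := 1) (by
    intro n hn
    have : n = 0 := by rwa [Nat.lt_one_iff, Finsupp.degree_eq_zero_iff] at hn
    subst this
    simp)
  rw [evalPair_sub, evalPair_C hξ hη] at h
  refine lt_of_lt_of_le ?_ h
  exact_mod_cast (by simpa using hω)

end evalPair

/-- The chain rule. -/
theorem euler_evalAt {ξ : QSeries} (hξ : 0 < ξ.orderTop) (F : Series2) :
    euler (evalAt F ξ) =
      evalAt (pderiv ℂ 0 F) ξ * euler ξ + evalAt (pderiv ℂ 1 F) ξ * mono 1 1 := by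
  have hη := orderTop_mono_one_pos
  obtain ⟨ω, hω, h1, h2⟩ := exists_pos_le_orderTop hξ hη
  simp only [evalAt_eq_evalPair]
  set η : QSeries := mono 1 1 with hηdef
  have hpoly : ∀ P : MvPolynomial (Fin 2) ℂ, euler (evalPair ξ η P) =
      evalPair ξ η (pderiv ℂ 0 (P : Series2)) * euler ξ +
        evalPair ξ η (pderiv ℂ 1 (P : Series2)) * η := by
    intro P
    simp only [pderiv_coe, evalPair_coe hξ hη]
    induction P using MvPolynomial.induction_on with
    | C a =>
      simp [HahnSeries.C_apply, euler_mono]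
    | add P Q hP hQ => simp only [map_add, euler_add, hP, hQ]; ring
    | mul_X P i hP =>
      have hη' : euler η = η := by simp [hηdef, euler_mono]
      simp only [map_mul, euler_mul, hP, Derivation.leibniz, map_add, smul_eq_mul,
        MvPolynomial.pderiv_X, MvPolynomial.eval₂Hom_X']
      fin_cases i
      · simp; ring
      · simp [hη']; ring
  have hd : ∀ (i : Fin 2) (M : ℕ) (n : Fin 2 →₀ ℕ), n.degree < M →
      coeff n (pderiv ℂ i (F - (truncTotal (M + 1) F : Series2))) = 0 := by
    intro i M n hn
    rw [coeff_pderiv, coeff_sub_truncTotal, zero_mul]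
    simpa using hn
  rw [← sub_eq_zero]
  refine eq_zero_of_forall_le_orderTop hω fun M => ?_
  -- Degree M + 1 rather than M, because the partial derivatives of the remainder lose one degree.
  set P := truncTotal (M + 1) F
  have e1 : F = P + (F - P) := by ring
  have e2 : euler (evalPair ξ η F) - (evalPair ξ η (pderiv ℂ 0 F) * euler ξ +
        evalPair ξ η (pderiv ℂ 1 F) * η) =
      euler (evalPair ξ η (F - P)) - (evalPair ξ η (pderiv ℂ 0 (F - P)) * euler ξ +
        evalPair ξ η (pderiv ℂ 1 (F - P)) * η) := by
    conv_lhs => rw [e1]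
    simp only [map_add, evalPair_add, euler_add, hpoly P]
    ring
  rw [e2]
  refine le_trans (le_min ?_ (le_trans (le_min ?_ ?_) HahnSeries.min_orderTop_le_orderTop_add))
    HahnSeries.min_orderTop_le_orderTop_sub
  · refine le_trans (le_orderTop_evalPair hξ hη h1 h2 hω.le fun n hn => ?_)
      (orderTop_le_orderTop_euler _)
    exact coeff_sub_truncTotal F (hn.trans (Nat.lt_succ_self M))
  · rw [HahnSeries.orderTop_mul]
    simpa using add_le_add (le_orderTop_evalPair hξ hη h1 h2 hω.le (hd 0 M))
      (hξ.le.trans (orderTop_le_orderTop_euler ξ))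
  · rw [HahnSeries.orderTop_mul]
    simpa using add_le_add (le_orderTop_evalPair hξ hη h1 h2 hω.le (hd 1 M)) hη.le

/-! ### The Newton-Puiseux theorem -/

section Puiseux

open Polynomial

variable {k : Type*} [Field k]

/-- The substitution `y ↦ y ^ D` of power series, as a ring homomorphism. -/
noncomputable def expandHom (D : ℕ) (hD : D ≠ 0) : PowerSeries k →+* PowerSeries k :=
  (PowerSeries.expand D hD).toRingHom

@[simp]
theorem expandHom_apply (D : ℕ) (hD : D ≠ 0) (a : PowerSeries k) :
    expandHom D hD a = PowerSeries.expand D hD a := rfl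

/-- The polynomial `W` over `k⟦y⟧` is a product of linear factors after the substitution
`y ↦ y ^ D`, for some positive integer `D`. -/
def PuiseuxSplits (W : (PowerSeries k)[X]) : Prop :=
  ∃ (D : ℕ) (hD : D ≠ 0), (W.map (expandHom D hD)).Splits

theorem PuiseuxSplits.of_splits {W : (PowerSeries k)[X]} (h : W.Splits) :
    PuiseuxSplits W := ⟨1, one_ne_zero, h.map _⟩

theorem map_expand_mul (W : (PowerSeries k)[X]) {D E : ℕ} (hD : D ≠ 0) (hE : E ≠ 0) :
    W.map (expandHom (D * E) (mul_ne_zero hD hE)) =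
      (W.map (expandHom E hE)).map
        (expandHom D hD) := by
  rw [Polynomial.map_map]
  congr 1
  ext1 a
  exact PowerSeries.expand_mul D hD E hE a

theorem PuiseuxSplits.mul {V W : (PowerSeries k)[X]} (hV : PuiseuxSplits V)
    (hW : PuiseuxSplits W) : PuiseuxSplits (V * W) := by
  obtain ⟨D, hD, h⟩ := hV
  obtain ⟨E, hE, h'⟩ := hW
  refine ⟨D * E, mul_ne_zero hD hE, ?_⟩
  rw [Polynomial.map_mul]
  refine Splits.mul ?_ ?_
  · simp only [mul_comm D E]
    rw [map_expand_mul V hE hD]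
    exact h.map _
  · rw [map_expand_mul W hD hE]
    exact h'.map _

theorem PuiseuxSplits.of_comp {W : (PowerSeries k)[X]} {a : PowerSeries k}
    (h : PuiseuxSplits (W.comp (Polynomial.X + Polynomial.C a))) : PuiseuxSplits W := by
  obtain ⟨D, hD, h⟩ := h
  refine ⟨D, hD, ?_⟩
  have := h.comp_X_sub_C ((expandHom D hD) a)
  simpa [Polynomial.map_comp, comp_assoc] using this

theorem PuiseuxSplits.of_scaleRoots {V W : (PowerSeries k)[X]} {r : PowerSeries k} {q : ℕ}
    (hq : q ≠ 0) (h : PuiseuxSplits V) (hV : V.Monic)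
    (hW : W.map (expandHom q hq) = V.scaleRoots r) :
    PuiseuxSplits W := by
  obtain ⟨D, hD, h⟩ := h
  refine ⟨D * q, mul_ne_zero hD hq, ?_⟩
  rw [map_expand_mul W hD hq, hW, map_scaleRoots _ _ _ (by simp [hV.leadingCoeff])]
  exact h.scaleRoots _

instance : IsAdicComplete (IsLocalRing.maximalIdeal (PowerSeries k)) (PowerSeries k) := by
  rw [PowerSeries.maximalIdeal_eq_span_X]; infer_instance

theorem residue_eq_zero_iff (a : PowerSeries k) :
    IsLocalRing.residue (PowerSeries k) a = 0 ↔ PowerSeries.constantCoeff a = 0 := by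
  rw [IsLocalRing.residue_eq_zero_iff, PowerSeries.maximalIdeal_eq_span_X,
    Ideal.mem_span_singleton, PowerSeries.X_dvd_iff]

/-- A weak form of Hensel's lemma for the factors `X ^ i` and `v / X ^ i` of the reduction `v`
of `U`. -/
theorem exists_factorization_of_reduction {U : (PowerSeries k)[X]} (hU : U.Monic)
    (h0 : PowerSeries.constantCoeff (U.coeff 0) = 0) {i : ℕ} (hi : i < U.natDegree)
    (hUi : PowerSeries.constantCoeff (U.coeff i) ≠ 0) :
    ∃ V W : (PowerSeries k)[X], V.Monic ∧ W.Monic ∧ V * W = U ∧ V.natDegree < U.natDegree ∧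
      W.natDegree < U.natDegree := by
  set R := PowerSeries.map (IsLocalRing.residue (PowerSeries k)) (U : PowerSeries (PowerSeries k))
    with hR
  have hRi : PowerSeries.coeff i R ≠ 0 := by
    rw [hR, PowerSeries.coeff_map, Polynomial.coeff_coe]
    rwa [ne_eq, residue_eq_zero_iff]
  have hR0 : PowerSeries.coeff 0 R = 0 := by
    rw [hR, PowerSeries.coeff_map, Polynomial.coeff_coe]
    rwa [residue_eq_zero_iff]
  have hne : R ≠ 0 := fun h => hRi (by simp [h])
  -- Weierstrass preparation for U read as a power series in its own variable: deg V is the order of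
  -- the reduction, which lies between 1 and i, so V is a proper factor.
  obtain ⟨V, Q, hVQ⟩ := PowerSeries.exists_isWeierstrassFactorization hne
  have hdeg := hVQ.natDegree_eq_toNat_order_map
  rw [← hR] at hdeg
  have hle : R.order ≤ i := PowerSeries.order_le i hRi
  have hge : 1 ≤ R.order := by
    rw [Order.one_le_iff_ne_zero]
    intro h
    have := PowerSeries.coeff_order hne
    rw [h] at this
    exact this (by simpa using hR0)
  have hVm : V.Monic := hVQ.isDistinguishedAt.monic
  have hlt : V.natDegree < U.natDegree := by
    rw [hdeg]
    exact lt_of_le_of_lt (ENat.toNat_le_of_le_natCast hle) hi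
  have hpos : 1 ≤ V.natDegree := by
    rw [hdeg]
    have hR : R.order ≠ ⊤ := ne_top_of_le_ne_top (ENat.natCast_ne_top i) hle
    exact (ENat.toNat_le_toNat hge hR)
  have hdvd : V ∣ U := by
    -- Since V is U times a unit, the polynomial remainder of U by V is a power series multiple of U
    -- of degree below the Weierstrass degree; uniqueness of Weierstrass division makes it zero.
    rw [← modByMonic_eq_zero_iff_dvd hVm]
    obtain ⟨Q', hQ'⟩ := hVQ.isUnit.exists_right_inv
    refine ((PowerSeries.IsWeierstrassDivisor.of_map_ne_zero hne).eq_zero_of_mul_eq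
      (q := Q' * (Q - (U /ₘ V : (PowerSeries k)[X]))) ?_ ?_).2
    · refine lt_of_lt_of_le (degree_modByMonic_lt U hVm) ?_
      rw [degree_eq_natDegree hVm.ne_zero, hdeg]
      exact le_rfl
    · have h1 := congrArg (fun P : (PowerSeries k)[X] => (P : PowerSeries (PowerSeries k)))
        (modByMonic_add_div U V)
      simp only [coe_add, coe_mul] at h1
      have h2 := hVQ.eq_mul
      linear_combination (-1 : PowerSeries (PowerSeries k)) * h1 +
        (U : PowerSeries (PowerSeries k)) * hQ' -
        (Q' * (U /ₘ V : (PowerSeries k)[X])) * h2 - (U /ₘ V : (PowerSeries k)[X]) * V * hQ'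
  obtain ⟨W, rfl⟩ := hdvd
  have hWm : W.Monic := hVm.of_mul_monic_left hU
  refine ⟨V, W, hVm, hWm, rfl, hlt, ?_⟩
  rw [hVm.natDegree_mul hWm] at *
  omega

/-- Serves twice in the Puiseux argument: to remove the subleading coefficient by a translation, and
to see that a reduction without that coefficient is not the power of X - a for any a ≠ 0. -/
theorem coeff_comp_X_add_C_of_natDegree_eq {R : Type*} [CommRing R] {W : R[X]} {m : ℕ}
    (hm : W.natDegree = m + 1) (c : R) :
    (W.comp (Polynomial.X + Polynomial.C c)).coeff m = W.coeff m + (m + 1) * W.coeff (m + 1) * c := by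
  rw [← taylor_apply, taylor_coeff, eval_eq_sum_range' (n := 2)]
  · simp [Finset.sum_range_succ, hasseDeriv_coeff, add_comm 1 m]
  · have := natDegree_hasseDeriv_le W m
    omega

/-- Induction on the degree. With the subleading coefficient removed, either a pure power of X is
left, or the substitution y ↦ y^q and a rescaling of the roots by y^p, with p/q the slope of the
first Newton edge, yield a polynomial whose reduction is not a power of one linear factor. Moving a
root of the reduction to 0 then allows a factorization into polynomials of smaller degree. -/
theorem puiseuxSplits_of_monic [IsAlgClosed k] [CharZero k] (W : (PowerSeries k)[X])
    (hW : W.Monic) : PuiseuxSplits W := by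
  induction hd : W.natDegree using Nat.strong_induction_on generalizing W with
  | _ d ih =>
  rcases d with _ | m
  · exact PuiseuxSplits.of_splits (Splits.of_natDegree_eq_zero hd)
  -- remove the term of degree `m`
  set c : PowerSeries k := -(PowerSeries.C ((m + 1 : k)⁻¹) * W.coeff m) with hc
  refine PuiseuxSplits.of_comp (a := c) ?_
  set T := W.comp (Polynomial.X + Polynomial.C c) with hT
  have hTm : T.Monic := hW.comp_X_add_C c
  have hTd : T.natDegree = m + 1 := by rw [hT, natDegree_comp]; simp [hd]
  have hTc : T.coeff m = 0 := by
    have h1 : W.coeff (m + 1) = 1 := by rw [← hd]; exact hW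
    have h2 : ((m : PowerSeries k) + 1) * PowerSeries.C ((m + 1 : k)⁻¹) = 1 := by
      have : ((m : PowerSeries k) + 1) = PowerSeries.C (m + 1 : k) := by simp
      rw [this, ← map_mul, mul_inv_cancel₀ (by exact_mod_cast Nat.succ_ne_zero m), map_one]
    rw [hT, coeff_comp_X_add_C_of_natDegree_eq hd, h1, hc]
    linear_combination (-W.coeff m) * h2
  clear_value T
  clear hT hc c hd hW W
  by_cases hz : ∀ i < m + 1, T.coeff i = 0
  · have : T = Polynomial.X ^ (m + 1) := by
      ext1 i
      rw [Polynomial.coeff_X_pow]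
      split_ifs with h
      · rw [h, ← hTd]; exact hTm
      · rcases lt_or_gt_of_ne h with h | h
        · exact hz i h
        · exact coeff_eq_zero_of_natDegree_lt (by omega)
    rw [this]
    exact PuiseuxSplits.of_splits (Splits.X_pow _)
  push Not at hz
  -- the first edge of the Newton polygon
  classical
  obtain ⟨i₀, hi₀, hmin⟩ := ((Finset.range (m + 1)).filter fun i => T.coeff i ≠ 0).exists_min_image
    (fun i => ((T.coeff i).order.toNat : ℚ) / ((m + 1 - i : ℕ) : ℚ)) (by
      obtain ⟨i, hi⟩ := hz
      exact ⟨i, by simpa using hi⟩)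
  simp only [Finset.mem_filter, Finset.mem_range] at hi₀ hmin
  set q := m + 1 - i₀ with hq
  set p := (T.coeff i₀).order.toNat with hp
  have hq0 : q ≠ 0 := by omega
  -- Minimality of the slope says p (m + 1 - i) ≤ q ord(T_i), which is exactly the divisibility
  -- needed to divide the roots by y^p.
  have hex : ∀ i, ∃ c : PowerSeries k, i ≤ m + 1 →
      PowerSeries.expand q hq0 (T.coeff i) = c * (PowerSeries.X ^ p) ^ (m + 1 - i) := by
    intro i
    by_cases hi : i < m + 1
    swap
    · refine ⟨PowerSeries.expand q hq0 (T.coeff i), fun h => ?_⟩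
      rw [show m + 1 - i = 0 by omega]; simp
    by_cases h0 : T.coeff i = 0
    · exact ⟨0, fun _ => by simp [h0]⟩
    have h1 := hmin i ⟨hi, h0⟩
    rw [div_le_div_iff₀ (by exact_mod_cast Nat.pos_of_ne_zero hq0)
      (by exact_mod_cast Nat.sub_pos_of_lt hi)] at h1
    norm_cast at h1
    obtain ⟨b, hb⟩ : PowerSeries.X ^ (T.coeff i).order.toNat ∣ T.coeff i := by
      rw [PowerSeries.X_pow_dvd_iff]
      intro n hn
      exact PowerSeries.coeff_of_lt_order_toNat n hn
    obtain ⟨r, hr⟩ := Nat.exists_eq_add_of_le h1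
    refine ⟨PowerSeries.X ^ r * PowerSeries.expand q hq0 b, fun _ => ?_⟩
    conv_lhs => rw [hb]
    rw [map_mul, map_pow, PowerSeries.expand_X, ← pow_mul, mul_comm q, hr, pow_add, pow_mul]
    ring
  choose b hb using hex
  set V : (PowerSeries k)[X] := Polynomial.X ^ (m + 1) + ∑ i ∈ Finset.range (m + 1), Polynomial.C (b i) * Polynomial.X ^ i with hV
  have hVlt : (∑ i ∈ Finset.range (m + 1), Polynomial.C (b i) * Polynomial.X ^ i).degree <
      ((m + 1 : ℕ) : WithBot ℕ) := by
    refine lt_of_le_of_lt (degree_sum_le _ _) ?_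
    rw [Finset.sup_lt_iff (WithBot.bot_lt_coe _)]
    intro i hi
    exact lt_of_le_of_lt (degree_C_mul_X_pow_le i _)
      (by exact_mod_cast Finset.mem_range.1 hi)
  have hVm : V.Monic := monic_X_pow_add hVlt
  have hVd : V.natDegree = m + 1 := by
    rw [hV, natDegree_add_eq_left_of_degree_lt (by simpa using hVlt), natDegree_X_pow]
  have hVc : ∀ i < m + 1, V.coeff i = b i := by
    intro i hi
    rw [hV, coeff_add, Polynomial.coeff_X_pow, if_neg hi.ne, zero_add, finsetSum_coeff]
    simp [Polynomial.coeff_C_mul, Polynomial.coeff_X_pow, hi]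
  -- The index i₀ lies on the edge, so the lowest coefficient of T_{i₀} becomes the constant term of
  -- b_{i₀}.
  have hbi₀ : PowerSeries.constantCoeff (b i₀) ≠ 0 := by
    have h := congrArg (PowerSeries.coeff (q * p)) (hb i₀ hi₀.1.le)
    rw [PowerSeries.coeff_expand_mul, ← pow_mul, ← hq, mul_comm q p] at h
    have h2 := PowerSeries.coeff_mul_X_pow (b i₀) (p * q) 0
    rw [zero_add] at h2
    rw [h2, PowerSeries.coeff_zero_eq_constantCoeff_apply] at h
    rw [← h]
    exact PowerSeries.coeff_order hi₀.2
  have hbm : b m = 0 := by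
    have := hb m (by omega)
    rw [hTc, map_zero] at this
    have := this.symm
    rw [mul_eq_zero] at this
    exact this.resolve_right (pow_ne_zero _ (pow_ne_zero _ PowerSeries.X_ne_zero))
  refine PuiseuxSplits.of_scaleRoots hq0 (V := V) (r := PowerSeries.X ^ p) ?_ hVm ?_
  swap
  · ext1 i
    rw [Polynomial.coeff_map, coeff_scaleRoots, hVd]
    rcases lt_trichotomy i (m + 1) with h | h | h
    · rw [hVc i h]; exact hb i h.le
    · subst h
      have h1 : T.coeff (m + 1) = 1 := by rw [← hTd]; exact hTm
      have h2 : V.coeff (m + 1) = 1 := by rw [← hVd]; exact hVm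
      simp [h1, h2]
    · rw [coeff_eq_zero_of_natDegree_lt (by omega), coeff_eq_zero_of_natDegree_lt (by omega)]
      simp
  -- the reduction of `V` has at least two distinct roots
  set v := V.map PowerSeries.constantCoeff with hv
  have hvm : v.Monic := hVm.map _
  have hvd : v.natDegree = m + 1 := by rw [hv, hVm.natDegree_map, hVd]
  obtain ⟨a, ha⟩ := IsAlgClosed.exists_root v (by
    rw [degree_eq_natDegree hvm.ne_zero, hvd]; exact_mod_cast Nat.succ_ne_zero m)
  refine PuiseuxSplits.of_comp (a := PowerSeries.C a) ?_
  set U := V.comp (Polynomial.X + Polynomial.C (PowerSeries.C a)) with hU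
  have hUm : U.Monic := hVm.comp_X_add_C _
  have hUd : U.natDegree = m + 1 := by rw [hU, natDegree_comp]; simp [hVd]
  have hUv : U.map PowerSeries.constantCoeff = v.comp (Polynomial.X + Polynomial.C a) := by
    rw [hU, Polynomial.map_comp]; simp [hv]
  have hU0 : PowerSeries.constantCoeff (U.coeff 0) = 0 := by
    rw [← Polynomial.coeff_map, hUv, coeff_zero_eq_eval_zero, eval_comp]
    simpa using ha
  have hUi : ∃ i < m + 1, PowerSeries.constantCoeff (U.coeff i) ≠ 0 := by
    -- Otherwise the reduction is (X - a)^(m+1). Its coefficient at X^m vanishes, so a = 0 in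
    -- characteristic zero, and then the coefficient at i₀ would vanish too.
    by_contra! hcon
    have h1 : v.comp (Polynomial.X + Polynomial.C a) = Polynomial.X ^ (m + 1) := by
      rw [← hUv]
      ext1 i
      rw [Polynomial.coeff_map, Polynomial.coeff_X_pow]
      split_ifs with h
      · rw [h, ← hUd, hUm.coeff_natDegree, map_one]
      · rcases lt_or_gt_of_ne h with h | h
        · exact hcon i h
        · rw [coeff_eq_zero_of_natDegree_lt (by omega), map_zero]
    have h2 := coeff_comp_X_add_C_of_natDegree_eq hvd a
    rw [h1, Polynomial.coeff_X_pow, if_neg (by omega), hv, Polynomial.coeff_map, hVc m (by omega), hbm, ← hv, ← hvd,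
      hvm.coeff_natDegree] at h2
    have ha0 : a = 0 := by
      have h3 : (m + 1 : k) ≠ 0 := by exact_mod_cast Nat.succ_ne_zero m
      simpa [h3] using h2
    rw [ha0] at h1
    have h4 := congrArg (fun P => P.coeff i₀) h1
    simp only [map_zero, add_zero, comp_X] at h4
    rw [Polynomial.coeff_X_pow, if_neg hi₀.1.ne, hv, Polynomial.coeff_map, hVc _ hi₀.1] at h4
    exact hbi₀ h4
  obtain ⟨i, hi, hUi⟩ := hUi
  obtain ⟨P, Q, hP, hQ, hPQ, hPd, hQd⟩ :=
    exists_factorization_of_reduction hUm hU0 (by rw [hUd]; exact hi) hUi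
  rw [hUd] at hPd hQd
  rw [← hPQ]
  exact (ih _ hPd P hP rfl).mul (ih _ hQd Q hQ rfl)

end Puiseux

/-! ### Power series in `x` over the power series in `y` -/

/-- The identification of `ℂ⟦y⟧⟦x⟧` with `ℂ⟦x, y⟧`. -/
noncomputable def toSeries2 : PowerSeries (PowerSeries ℂ) →+* Series2 :=
  ((finSuccEquiv ℂ 1).symm : PowerSeries (MvPowerSeries (Fin 1) ℂ) →+* Series2).comp
    (PowerSeries.map
      ((renameEquiv ℂ (Equiv.ofUnique (Fin 1) Unit)).symm :
        PowerSeries ℂ →+* MvPowerSeries (Fin 1) ℂ))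

theorem coeff_toSeries2 (G : PowerSeries (PowerSeries ℂ)) (n : Fin 2 →₀ ℕ) :
    coeff n (toSeries2 G) = PowerSeries.coeff (n 1) (PowerSeries.coeff (n 0) G) := by
  set F := toSeries2 G with hF
  have hn : n = (Finsupp.single 0 (n 1) : Fin 1 →₀ ℕ).cons (n 0) := by
    ext i
    refine Fin.cases ?_ (fun j => ?_) i
    · simp
    · rw [Finsupp.cons_succ]
      fin_cases j
      simp
  have h1 : finSuccEquiv ℂ 1 F = PowerSeries.map
      ((renameEquiv ℂ (Equiv.ofUnique (Fin 1) Unit)).symm :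
        PowerSeries ℂ →+* MvPowerSeries (Fin 1) ℂ) G := by
    rw [hF, toSeries2]
    exact (finSuccEquiv ℂ 1).apply_symm_apply _
  rw [hn, ← coeff_coeff_finSuccEquiv, h1, PowerSeries.coeff_map]
  simp only [Finsupp.cons_zero]
  have h2 := coeff_embDomain_rename (Equiv.ofUnique (Fin 1) Unit).symm.symm.symm.toEmbedding
    (PowerSeries.coeff (n 0) G : MvPowerSeries Unit ℂ) (Finsupp.single () (n 1))
  rw [Finsupp.embDomain_single] at h2
  refine Eq.trans ?_ (h2.trans ?_)
  · rfl
  · have : (Finsupp.cons (n 0) (Finsupp.single 0 (n 1) : Fin 1 →₀ ℕ)) 1 = n 1 := by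
      rw [← hn]
    rw [this]
    rfl

theorem toSeries2_surjective : Function.Surjective toSeries2 := by
  intro F
  refine ⟨PowerSeries.mk fun i => PowerSeries.mk fun j =>
    coeff (Finsupp.single 0 i + Finsupp.single 1 j) F, ?_⟩
  ext n
  rw [coeff_toSeries2, PowerSeries.coeff_mk, PowerSeries.coeff_mk]
  congr 2
  ext i
  fin_cases i <;> simp

theorem pderiv_toSeries2 (G : PowerSeries (PowerSeries ℂ)) :
    pderiv ℂ 0 (toSeries2 G) = toSeries2 (PowerSeries.derivative (PowerSeries ℂ) G) := by
  ext n
  rw [coeff_pderiv, coeff_toSeries2, coeff_toSeries2, PowerSeries.coeff_derivative]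
  simp only [Finsupp.add_apply, Finsupp.single_eq_same]
  have : ((n 0 : PowerSeries ℂ) + 1) = PowerSeries.C (n 0 + 1 : ℂ) := by simp
  rw [this, PowerSeries.coeff_mul_C]
  simp

theorem iterate_pderiv_toSeries2 (W : Polynomial (PowerSeries ℂ)) (j : ℕ) :
    (fun G : Series2 => pderiv ℂ 0 G)^[j] (toSeries2 (W : PowerSeries (PowerSeries ℂ))) =
      toSeries2 ((Polynomial.derivative^[j] W : Polynomial (PowerSeries ℂ)) :
        PowerSeries (PowerSeries ℂ)) := by
  induction j with
  | zero => rfl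
  | succ j ih =>
    rw [Function.iterate_succ_apply', Function.iterate_succ_apply', ih, pderiv_toSeries2,
      PowerSeries.derivative_coe]

theorem toSeries2_X : toSeries2 PowerSeries.X = X 0 := by
  ext n
  rw [coeff_toSeries2, PowerSeries.coeff_X, coeff_X]
  have : n = Finsupp.single 0 1 ↔ n 0 = 1 ∧ n 1 = 0 := by
    constructor
    · rintro rfl; simp
    · rintro ⟨h0, h1⟩; ext i; fin_cases i <;> simp [h0, h1]
  by_cases h0 : n 0 = 1 <;> by_cases h1 : n 1 = 0 <;>
    simp [this, h0, h1, PowerSeries.coeff_one]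

theorem toSeries2_C_X : toSeries2 (PowerSeries.C PowerSeries.X) = X 1 := by
  ext n
  rw [coeff_toSeries2, PowerSeries.coeff_C, coeff_X]
  have : n = Finsupp.single 1 1 ↔ n 0 = 0 ∧ n 1 = 1 := by
    constructor
    · rintro rfl; simp
    · rintro ⟨h0, h1⟩; ext i; fin_cases i <;> simp [h0, h1]
  by_cases h0 : n 0 = 0 <;> by_cases h1 : n 1 = 1 <;>
    simp [this, h0, h1, PowerSeries.coeff_X]

theorem toSeries2_C_C (c : ℂ) : toSeries2 (PowerSeries.C (PowerSeries.C c)) = C c := by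
  ext n
  rw [coeff_toSeries2, PowerSeries.coeff_C, coeff_C]
  have : n = 0 ↔ n 0 = 0 ∧ n 1 = 0 := by
    constructor
    · rintro rfl; simp
    · rintro ⟨h0, h1⟩; ext i; fin_cases i <;> simp [h0, h1]
  by_cases h0 : n 0 = 0 <;> by_cases h1 : n 1 = 0 <;>
    simp [this, h0, h1, PowerSeries.coeff_C]

theorem constantCoeff_toSeries2 (G : PowerSeries (PowerSeries ℂ)) :
    constantCoeff (toSeries2 G) = PowerSeries.constantCoeff (PowerSeries.constantCoeff G) := by
  rw [← coeff_zero_eq_constantCoeff_apply, coeff_toSeries2]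
  simp

/-! ### Puiseux series as power series in a fractional power of `y` -/

/-- The substitution `a(t) ↦ a(y ^ (1 / D))`. -/
noncomputable def puiseux (D : ℕ) (hD : D ≠ 0) : PowerSeries ℂ →+* QSeries :=
  (HahnSeries.embDomainRingHom
    ({ toFun := fun n : ℕ => (n : ℚ) / D, map_zero' := by simp,
       map_add' := fun a b => by push_cast; ring } : ℕ →+ ℚ)
    (fun a b h => by
      have hD' : (D : ℚ) ≠ 0 := by exact_mod_cast hD
      have : (a : ℚ) / D = b / D := h
      field_simp at this
      exact_mod_cast this)
    (fun a b => by
      have hD' : (0 : ℚ) < D := by exact_mod_cast Nat.pos_of_ne_zero hD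
      change (a : ℚ) / D ≤ b / D ↔ _
      rw [div_le_div_iff_of_pos_right hD']
      exact Nat.cast_le)).comp
    (HahnSeries.toPowerSeries (R := ℂ)).symm.toRingHom

theorem puiseux_injective (D : ℕ) (hD : D ≠ 0) : Function.Injective (puiseux D hD) := by
  intro a b h
  exact HahnSeries.toPowerSeries.symm.injective (HahnSeries.embDomain_injective h)

theorem mem_support_puiseux {D : ℕ} {hD : D ≠ 0} {a : PowerSeries ℂ} {e : ℚ}
    (he : e ∈ (puiseux D hD a).support) :
    ∃ n : ℕ, PowerSeries.coeff n a ≠ 0 ∧ e = (n : ℚ) / D := by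
  obtain ⟨n, hn, rfl⟩ := HahnSeries.support_embDomain_subset he
  exact ⟨n, by simpa using hn, rfl⟩

theorem puiseux_C (D : ℕ) (hD : D ≠ 0) (c : ℂ) :
    puiseux D hD (PowerSeries.C c) = mono 0 c := by
  have : HahnSeries.toPowerSeries.symm (PowerSeries.C c) = HahnSeries.C c := by
    ext n
    rw [HahnSeries.coeff_toPowerSeries_symm, PowerSeries.coeff_C, HahnSeries.C_apply]
    by_cases h : n = 0 <;> simp [h]
  simp only [puiseux, RingHom.comp_apply, RingEquiv.toRingHom_eq_coe, RingEquiv.coe_toRingHom, this]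
  exact HahnSeries.embDomainRingHom_C

theorem puiseux_X (D : ℕ) (hD : D ≠ 0) :
    puiseux D hD PowerSeries.X = mono ((1 : ℚ) / D) 1 := by
  have : HahnSeries.toPowerSeries.symm (PowerSeries.X : PowerSeries ℂ) =
      HahnSeries.single 1 1 := by
    ext n
    rw [HahnSeries.coeff_toPowerSeries_symm, PowerSeries.coeff_X]
    by_cases h : n = 1 <;> simp [h]
  simp only [puiseux, RingHom.comp_apply, RingEquiv.toRingHom_eq_coe, RingEquiv.coe_toRingHom, this]
  refine HahnSeries.embDomain_single.trans ?_
  congr 1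

theorem orderTop_puiseux_nonneg (D : ℕ) (hD : D ≠ 0) (a : PowerSeries ℂ) :
    0 ≤ (puiseux D hD a).orderTop := by
  rw [HahnSeries.le_orderTop_iff_forall]
  intro e he
  by_contra h
  obtain ⟨n, -, rfl⟩ := mem_support_puiseux h
  have : (0 : ℚ) ≤ n / D := by positivity
  exact absurd he (not_lt.2 (by exact_mod_cast this))

theorem isArc_puiseux {D : ℕ} (hD : D ≠ 0) {a : PowerSeries ℂ}
    (ha : PowerSeries.constantCoeff a = 0) : IsArc (puiseux D hD a) := by
  refine ⟨D, Nat.pos_of_ne_zero hD, fun e he => ?_⟩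
  obtain ⟨n, hn, rfl⟩ := mem_support_puiseux he
  refine ⟨n, Nat.pos_of_ne_zero fun h => hn ?_, rfl⟩
  simpa [h] using ha

theorem IsArc.orderTop_pos {ξ : QSeries} (h : IsArc ξ) : 0 < ξ.orderTop := by
  obtain ⟨D, hD, h⟩ := h
  by_cases h0 : ξ = 0
  · simp [h0]
  obtain ⟨e, c, hc, he, hl⟩ := hasLeadingTerm_of_ne_zero h0
  obtain ⟨n, hn, rfl⟩ := h e (by
    rw [HahnSeries.mem_support, hl.coeff]
    exact hc)
  rw [he]
  have : (0 : ℚ) < n / D := by positivity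
  exact_mod_cast this

/-- Ring homomorphisms from power series to Hahn series which take values of nonnegative order
are determined by the images of the constants and of the variable. -/
theorem powerSeries_ringHom_ext {φ ψ : PowerSeries ℂ →+* QSeries}
    (hφ : ∀ a, 0 ≤ (φ a).orderTop) (hψ : ∀ a, 0 ≤ (ψ a).orderTop)
    (hC : ∀ c, φ (PowerSeries.C c) = ψ (PowerSeries.C c))
    (hX : φ PowerSeries.X = ψ PowerSeries.X) (hpos : 0 < (φ PowerSeries.X).orderTop) : φ = ψ := by
  obtain ⟨ω, hω, h1, -⟩ := exists_pos_le_orderTop hpos hpos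
  have hpoly : φ.comp Polynomial.coeToPowerSeries.ringHom =
      ψ.comp Polynomial.coeToPowerSeries.ringHom := by
    refine Polynomial.ringHom_ext (fun c => ?_) ?_
    · simpa using hC c
    · simpa using hX
  ext1 a
  rw [← sub_eq_zero]
  refine eq_zero_of_forall_le_orderTop hω fun N => ?_
  obtain ⟨b, hb⟩ : PowerSeries.X ^ N ∣ a - (PowerSeries.trunc N a : PowerSeries ℂ) := by
    rw [PowerSeries.X_pow_dvd_iff]
    intro n hn
    simp [PowerSeries.coeff_trunc, hn]
  have ha : a = (PowerSeries.trunc N a : PowerSeries ℂ) + PowerSeries.X ^ N * b := by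
    rw [← hb]; ring
  have h2 := RingHom.congr_fun hpoly (PowerSeries.trunc N a)
  simp only [RingHom.comp_apply, Polynomial.coeToPowerSeries.ringHom_apply] at h2
  have h3 : φ a - ψ a = φ PowerSeries.X ^ N * (φ b - ψ b) := by
    rw [ha, map_add, map_add, h2, map_mul, map_mul, map_pow, map_pow, hX]
    ring
  rw [h3, HahnSeries.orderTop_mul]
  simpa using add_le_add (le_orderTop_pow h1 N)
    (le_trans (le_min (hφ b) (hψ b)) HahnSeries.min_orderTop_le_orderTop_sub)

/-- Putting y^(1/D) into a(y^D) gives back a(y); thus a splitting obtained after y ↦ y^D yields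
fractional power series roots of the original polynomial. -/
theorem puiseux_comp_expandHom (D : ℕ) (hD : D ≠ 0) :
    (puiseux D hD).comp (expandHom D hD) = puiseux 1 one_ne_zero := by
  have hD' : (D : ℚ) ≠ 0 := by exact_mod_cast hD
  have hX : (puiseux D hD).comp (expandHom D hD) PowerSeries.X =
      puiseux 1 one_ne_zero PowerSeries.X := by
    rw [RingHom.comp_apply, expandHom_apply, PowerSeries.expand_X, map_pow, puiseux_X, puiseux_X,
      HahnSeries.single_pow]
    simp [hD']
  refine powerSeries_ringHom_ext (fun a => orderTop_puiseux_nonneg D hD _)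
    (fun a => orderTop_puiseux_nonneg _ _ _) (fun c => ?_) hX ?_
  · rw [RingHom.comp_apply, expandHom_apply, PowerSeries.expand_C, puiseux_C, puiseux_C]
  · rw [hX, puiseux_X]
    simp

/-- Evaluation at a Hahn series of positive order, as a ring homomorphism. -/
noncomputable def evalAtHom {ξ : QSeries} (hξ : 0 < ξ.orderTop) : Series2 →+* QSeries :=
  evalHom hξ orderTop_mono_one_pos

theorem evalAtHom_apply {ξ : QSeries} (hξ : 0 < ξ.orderTop) (F : Series2) :
    evalAtHom hξ F = evalAt F ξ := rfl

/-- Both sides are ring homomorphisms in W, so it suffices to compare them on coefficients, by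
`powerSeries_ringHom_ext`, and on the variable. Evaluation along an arc thereby becomes evaluation
of a one-variable polynomial. -/
theorem evalAt_toSeries2 {ξ : QSeries} (hξ : 0 < ξ.orderTop) (W : Polynomial (PowerSeries ℂ)) :
    evalAt (toSeries2 (W : PowerSeries (PowerSeries ℂ))) ξ =
      (W.map (puiseux 1 one_ne_zero)).eval ξ := by
  have hη := orderTop_mono_one_pos
  have hC : (evalAtHom hξ).comp (toSeries2.comp PowerSeries.C) = puiseux 1 one_ne_zero := by
    have hX : (evalAtHom hξ).comp (toSeries2.comp PowerSeries.C) PowerSeries.X =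
        puiseux 1 one_ne_zero PowerSeries.X := by
      rw [RingHom.comp_apply, RingHom.comp_apply, toSeries2_C_X, evalAtHom_apply,
        evalAt_eq_evalPair, evalPair_X_one hξ hη, puiseux_X]
      simp
    refine powerSeries_ringHom_ext (fun a => orderTop_evalPair_nonneg hξ hη _)
      (fun a => orderTop_puiseux_nonneg _ _ _) (fun c => ?_) hX ?_
    · rw [RingHom.comp_apply, RingHom.comp_apply, toSeries2_C_C, evalAtHom_apply,
        evalAt_eq_evalPair, evalPair_C hξ hη, puiseux_C]
    · rw [hX, puiseux_X]
      simp
  have key : ((evalAtHom hξ).comp toSeries2).comp Polynomial.coeToPowerSeries.ringHom =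
      Polynomial.eval₂RingHom (puiseux 1 one_ne_zero) ξ := by
    refine Polynomial.ringHom_ext (fun a => ?_) ?_
    · rw [← hC]; simp
    · simp [toSeries2_X, evalAtHom_apply, evalAt_eq_evalPair, evalPair_X_zero hξ hη]
  rw [Polynomial.eval_map]
  exact RingHom.congr_fun key W

/-! ### Factorization of a germ into its Newton-Puiseux roots -/

/-- The `x`-derivative, as a function. -/
noncomputable abbrev dx (G : Series2) : Series2 := pderiv ℂ 0 G

/-- The multiset `R` of arcs is the multiset of Newton-Puiseux roots of `F`: up to a factor
without roots, `F` is the product of the `x - α`, `α ∈ R`. -/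
def HasRootMultiset (F : Series2) (R : Multiset QSeries) : Prop :=
  (∀ α ∈ R, IsArc α) ∧ ∃ (k : ℕ) (U V : Series2), constantCoeff U ≠ 0 ∧ F = X 1 ^ k * U * V ∧
    ∀ ξ : QSeries, 0 < ξ.orderTop → ∀ j : ℕ, evalAt (dx^[j] V) ξ =
      (Polynomial.derivative^[j] (R.map fun α => Polynomial.X - Polynomial.C α).prod).eval ξ

/-- Dividing by the largest power of y makes the germ regular in x, as Weierstrass preparation
requires. -/
theorem exists_toSeries2_eq {F : Series2} (hF : F ≠ 0) :
    ∃ (k : ℕ) (G : PowerSeries (PowerSeries ℂ)) (i : ℕ), F = X 1 ^ k * toSeries2 G ∧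
      PowerSeries.constantCoeff (PowerSeries.coeff i G) ≠ 0 := by
  obtain ⟨G, rfl⟩ := toSeries2_surjective F
  have hG : ∃ d, ∃ i, PowerSeries.coeff d (PowerSeries.coeff i G) ≠ 0 := by
    by_contra! h
    refine hF ?_
    rw [show G = 0 from PowerSeries.ext fun i => PowerSeries.ext fun d => by simpa using h d i,
      map_zero]
  classical
  obtain ⟨i, hi⟩ := Nat.find_spec hG
  have hdvd : ∀ i, ∃ b, PowerSeries.coeff i G = PowerSeries.X ^ Nat.find hG * b := by
    intro i
    change PowerSeries.X ^ Nat.find hG ∣ PowerSeries.coeff i G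
    rw [PowerSeries.X_pow_dvd_iff]
    intro d hd
    have := Nat.find_min hG hd
    push Not at this
    exact this i
  choose b hb using hdvd
  refine ⟨Nat.find hG, PowerSeries.mk b, i, ?_, ?_⟩
  · rw [← toSeries2_C_X, ← map_pow, ← map_mul]
    congr 1
    ext1 j
    rw [← map_pow, PowerSeries.coeff_C_mul, PowerSeries.coeff_mk, hb]
  · rw [PowerSeries.coeff_mk]
    rw [hb] at hi
    have := PowerSeries.coeff_X_pow_mul (b i) (Nat.find hG) 0
    rw [zero_add] at this
    rwa [this, PowerSeries.coeff_zero_eq_constantCoeff_apply] at hi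

/-- The roots are those of the Weierstrass polynomial of F, which splits by Newton-Puiseux. They
have positive order because that polynomial reduces to a power of x at y = 0. -/
theorem exists_hasRootMultiset {F : Series2} (hF : F ≠ 0) : ∃ R, HasRootMultiset F R := by
  obtain ⟨k, G, i, rfl, hi⟩ := exists_toSeries2_eq hF
  have hne : PowerSeries.map (IsLocalRing.residue (PowerSeries ℂ)) G ≠ 0 := by
    intro h
    have := congrArg (PowerSeries.coeff i) h
    rw [PowerSeries.coeff_map, map_zero, residue_eq_zero_iff] at this
    exact hi this
  obtain ⟨W, U, hWU⟩ := PowerSeries.exists_isWeierstrassFactorization hne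
  have hWm := hWU.isDistinguishedAt.monic
  have hW0 : W.map PowerSeries.constantCoeff = Polynomial.X ^ W.natDegree := by
    ext j
    rw [Polynomial.coeff_map, Polynomial.coeff_X_pow]
    split_ifs with h
    · rw [h, hWm.coeff_natDegree, map_one]
    · rcases lt_or_gt_of_ne h with h | h
      · rw [← residue_eq_zero_iff, IsLocalRing.residue_eq_zero_iff]
        exact hWU.isDistinguishedAt.mem h
      · rw [Polynomial.coeff_eq_zero_of_natDegree_lt h, map_zero]
  obtain ⟨D, hD, hs⟩ := puiseuxSplits_of_monic W hWm
  set W' := W.map (expandHom D hD) with hW'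
  have hmap : W.map (puiseux 1 one_ne_zero) = W'.map (puiseux D hD) := by
    rw [hW', Polynomial.map_map, puiseux_comp_expandHom]
  have hsplit := hs.map (puiseux D hD)
  have hroots := hs.roots_map_of_injective (puiseux_injective D hD)
  have hm : (W'.map (puiseux D hD)).Monic := (hWm.map _).map _
  have hprod := hsplit.eq_prod_roots_of_monic hm
  refine ⟨(W'.map (puiseux D hD)).roots, ?_, k, toSeries2 U,
    toSeries2 (W : PowerSeries (PowerSeries ℂ)), ?_, ?_, ?_⟩
  · intro α hα
    rw [hroots, Multiset.mem_map] at hα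
    obtain ⟨a, ha, rfl⟩ := hα
    refine isArc_puiseux hD ?_
    have h1 : W'.eval a = 0 := (Polynomial.mem_roots'.1 ha).2
    have h2 : (W'.map PowerSeries.constantCoeff).eval (PowerSeries.constantCoeff a) = 0 := by
      rw [Polynomial.eval_map, Polynomial.eval₂_at_apply, h1, map_zero]
    have h3 : (PowerSeries.constantCoeff (R := ℂ)).comp (expandHom D hD) =
        PowerSeries.constantCoeff := by
      ext1 b; simp
    rw [hW', Polynomial.map_map, h3, hW0, Polynomial.eval_pow, Polynomial.eval_X] at h2
    exact eq_zero_of_pow_eq_zero h2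
  · rw [constantCoeff_toSeries2]
    have := hWU.isUnit
    rw [PowerSeries.isUnit_iff_constantCoeff, PowerSeries.isUnit_iff_constantCoeff] at this
    exact this.ne_zero
  · rw [hWU.eq_mul, map_mul]; ring
  · intro ξ hξ j
    rw [iterate_pderiv_toSeries2, evalAt_toSeries2 hξ, ← hprod, ← hmap,
      Polynomial.iterate_derivative_map]

/-- If the derivatives of `V` of order less than `m` vanish at a point, only one term of the
Leibniz formula for the `m`-th derivative of `P * V` survives. -/
theorem iterate_derivation_mul {K : Type*} [CommRing K] (E : Series2 →+* K) (m : ℕ)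
    (P V : Series2) (h : ∀ i < m, E (dx^[i] V) = 0) :
    E (dx^[m] (P * V)) = E P * E (dx^[m] V) := by
  have hadd : ∀ (m : ℕ) (A B : Series2), dx^[m] (A + B) = dx^[m] A + dx^[m] B := by
    intro m
    induction m with
    | zero => intro A B; rfl
    | succ m ih => intro A B; simp [Function.iterate_succ_apply, ih]
  induction m generalizing P V with
  | zero => simp
  | succ m ih =>
    have h1 : dx (P * V) = P * dx V + dx P * V := by
      simp [dx, Derivation.leibniz, smul_eq_mul, mul_comm]
    rw [Function.iterate_succ_apply, h1, hadd, map_add, ih P (dx V), ih (dx P) V,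
      h m (Nat.lt_succ_self m), ← Function.iterate_succ_apply]
    · simp
    · exact fun i hi => h i (by omega)
    · intro i hi
      rw [← Function.iterate_succ_apply]
      exact h (i + 1) (by omega)

namespace HasRootMultiset

variable {F : Series2} {R : Multiset QSeries}

theorem exists_factorization (h : HasRootMultiset F R) : ∃ P V : Series2, F = P * V ∧
    (∀ ξ : QSeries, 0 < ξ.orderTop → evalAt P ξ ≠ 0) ∧
    ∀ ξ : QSeries, 0 < ξ.orderTop → ∀ j : ℕ, evalAt (dx^[j] V) ξ =
      (Polynomial.derivative^[j] (R.map fun α => Polynomial.X - Polynomial.C α).prod).eval ξ := by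
  obtain ⟨-, k, U, V, hU, hF, hV⟩ := h
  refine ⟨_, V, hF, fun ξ hξ => ?_, hV⟩
  have hη := orderTop_mono_one_pos
  rw [← evalAtHom_apply hξ, map_mul, map_pow, evalAtHom_apply, evalAtHom_apply,
    evalAt_eq_evalPair, evalAt_eq_evalPair, evalPair_X_one hξ hη]
  exact mul_ne_zero (pow_ne_zero _ (by simp)) ((hasLeadingTerm_evalPair hξ hη U).ne_zero hU)

theorem evalAt_eq_zero_iff (h : HasRootMultiset F R) {ξ : QSeries} (hξ : 0 < ξ.orderTop) :
    evalAt F ξ = 0 ↔ ξ ∈ R := by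
  obtain ⟨P, V, rfl, hP, hV⟩ := h.exists_factorization
  have h0 := hV ξ hξ 0
  simp only [Function.iterate_zero, id] at h0
  rw [← evalAtHom_apply hξ, map_mul, evalAtHom_apply, evalAtHom_apply, h0,
    mul_eq_zero, or_iff_right (hP ξ hξ), Polynomial.eval_multiset_prod, Multiset.prod_eq_zero_iff]
  simp [sub_eq_zero]

theorem mem_roots_iff (h : HasRootMultiset F R) {ξ : QSeries} : ξ ∈ roots F ↔ ξ ∈ R := by
  constructor
  · rintro ⟨h1, h2⟩
    exact (h.evalAt_eq_zero_iff h1.orderTop_pos).1 h2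
  · intro h1
    exact ⟨h.1 ξ h1, (h.evalAt_eq_zero_iff (h.1 ξ h1).orderTop_pos).2 h1⟩

open scoped Classical in
-- Up to the multiplicity of ξ in the product V of linear factors, `iterate_derivation_mul` lets the
-- rootless factor P enter only as a nonzero scalar, so the first nonvanishing derivative is that of
-- V.
theorem rootMult_eq (h : HasRootMultiset F R) {ξ : QSeries} (hξ : 0 < ξ.orderTop) :
    rootMult F ξ = R.count ξ := by
  obtain ⟨P, V, rfl, hP, hV⟩ := h.exists_factorization
  set Q := (R.map fun α => Polynomial.X - Polynomial.C α).prod with hQ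
  have hQ0 : Q ≠ 0 := (Polynomial.monic_multiset_prod_of_monic _ _
    fun α _ => Polynomial.monic_X_sub_C α).ne_zero
  have hcount : R.count ξ = Q.rootMultiplicity ξ := by
    rw [← Polynomial.count_roots, hQ, Polynomial.roots_multiset_prod_X_sub_C]
  have hlt : ∀ i < R.count ξ, evalAt (dx^[i] V) ξ = 0 := by
    intro i hi
    rw [hV ξ hξ]
    exact Polynomial.isRoot_iterate_derivative_of_lt_rootMultiplicity (hcount ▸ hi)
  have heq : evalAt (dx^[R.count ξ] V) ξ ≠ 0 := by
    rw [hV ξ hξ, hcount, Polynomial.eval_iterate_derivative_rootMultiplicity]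
    rw [nsmul_eq_mul]
    have : CharZero QSeries := charZero_of_injective_algebraMap (algebraMap ℂ QSeries).injective
    exact mul_ne_zero (Nat.cast_ne_zero.2 (Nat.factorial_ne_zero _))
      (Polynomial.eval_divByMonic_pow_rootMultiplicity_ne_zero _ hQ0)
  have key : ∀ i ≤ R.count ξ, evalAt (dx^[i] (P * V)) ξ = evalAt P ξ * evalAt (dx^[i] V) ξ :=
    fun i hi => iterate_derivation_mul (evalAtHom hξ) i P V fun j hj => hlt j (hj.trans_le hi)
  refine le_antisymm (iInf₂_le _ ?_) (le_iInf₂ fun i hi => ?_)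
  · change evalAt (dx^[R.count ξ] (P * V)) ξ ≠ 0
    rw [key _ le_rfl]
    exact mul_ne_zero (hP ξ hξ) heq
  · by_contra hcon
    have hi' : i < R.count ξ := by simpa using hcon
    refine hi ?_
    change evalAt (dx^[i] (P * V)) ξ = 0
    rw [key i hi'.le, hlt i hi', mul_zero]

end HasRootMultiset

/-! ### Initial forms -/

/-- The Hahn series `ξ = c + a y ^ h + ⋯` climbs over `c` with coefficient `a`. -/
def ClimbsOver (c : QSeries) (h : ℚ) (ξ : QSeries) (a : ℂ) : Prop :=
  (h : WithTop ℚ) < (ξ - (c + mono h a)).orderTop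

theorem climbsOver_iff {c ξ : QSeries} {h : ℚ} {a : ℂ} :
    ClimbsOver c h ξ a ↔ HasLeadingTerm (ξ - c) h a := by
  rw [ClimbsOver, HasLeadingTerm, sub_sub]

theorem exists_climbsOver_iff {c ξ : QSeries} {h : ℚ} :
    (∃ a, ClimbsOver c h ξ a) ↔ (h : WithTop ℚ) ≤ (ξ - c).orderTop := by
  simp only [climbsOver_iff, hasLeadingTerm_iff]
  exact ⟨fun ⟨a, h1, _⟩ => h1, fun h1 => ⟨_, h1, rfl⟩⟩

theorem ClimbsOver.orderTop_pos {c ξ : QSeries} {h : ℚ} {a : ℂ} (hξ : ClimbsOver c h ξ a)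
    (hh : 0 < h) (hc : 0 < c.orderTop) : 0 < ξ.orderTop := by
  have h1 : (0 : WithTop ℚ) < (ξ - c).orderTop :=
    lt_of_lt_of_le (by exact_mod_cast hh) (climbsOver_iff.1 hξ).le
  have h2 : ξ = (ξ - c) + c := by ring
  rw [h2]
  exact lt_of_lt_of_le (lt_min h1 hc) HahnSeries.min_orderTop_le_orderTop_add

/-- Along all Hahn series `ξ = c + a y ^ h + ⋯` the functions `u` and `v`, the latter thought
of as the derivative of the former, have the expansions `u(ξ) = P(a) y ^ ν + ⋯` and
`v(ξ) = P'(a) y ^ (ν - h) + ⋯`. -/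
def HasInitialForm (c : QSeries) (h : ℚ) (u v : QSeries → QSeries) (ν : ℚ)
    (P : Polynomial ℂ) : Prop :=
  ∀ ξ a, ClimbsOver c h ξ a → HasLeadingTerm (u ξ) ν (P.eval a) ∧
    HasLeadingTerm (v ξ) (ν - h) ((Polynomial.derivative P).eval a)

namespace HasInitialForm

variable {c : QSeries} {h : ℚ}

/-- The Leibniz rule for (u, v) matches the one for polynomials; initial forms of products can
therefore be built factor by factor. -/
theorem mul {u v u' v' : QSeries → QSeries} {ν ν' : ℚ} {P P' : Polynomial ℂ}
    (H : HasInitialForm c h u v ν P) (H' : HasInitialForm c h u' v' ν' P') :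
    HasInitialForm c h (fun ξ => u ξ * u' ξ) (fun ξ => v ξ * u' ξ + u ξ * v' ξ) (ν + ν')
      (P * P') := by
  intro ξ a hξ
  obtain ⟨h1, h2⟩ := H ξ a hξ
  obtain ⟨h3, h4⟩ := H' ξ a hξ
  refine ⟨by simpa using h1.mul h3, ?_⟩
  have h5 := h2.mul h3
  have h6 := h1.mul h4
  rw [show ν - h + ν' = ν + ν' - h by ring] at h5
  rw [show ν + (ν' - h) = ν + ν' - h by ring] at h6
  simpa using h5.add h6

theorem sub_const_of_climbsOver {α : QSeries} {b : ℂ} (hα : ClimbsOver c h α b) :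
    HasInitialForm c h (fun ξ => ξ - α) (fun _ => 1) h (Polynomial.X - Polynomial.C b) := by
  intro ξ a hξ
  rw [climbsOver_iff] at hα hξ
  refine ⟨?_, ?_⟩
  · simpa using hξ.sub hα
  · simpa using hasLeadingTerm_mono 0 1

/-- A root leaving c below height h has the same difference, to leading order, with every climbing
ξ. It contributes a constant, hence nothing to the degree. -/
theorem sub_const_of_lt {α : QSeries} (hα : (α - c).orderTop < h) :
    ∃ (ν : ℚ) (b : ℂ), b ≠ 0 ∧
      HasInitialForm c h (fun ξ => ξ - α) (fun _ => 1) ν (Polynomial.C b) := by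
  have hne : α - c ≠ 0 := by
    rintro h0; simp [h0] at hα
  obtain ⟨e, b, hb, he, hl⟩ := hasLeadingTerm_of_ne_zero hne
  rw [he, WithTop.coe_lt_coe] at hα
  refine ⟨e, -b, neg_ne_zero.2 hb, fun ξ a hξ => ⟨?_, ?_⟩⟩
  · simpa using ((climbsOver_iff.1 hξ).zero_of_lt hα).sub hl
  · have h1 : HasLeadingTerm 1 0 1 := hasLeadingTerm_mono 0 1
    simpa using h1.zero_of_lt (sub_neg.2 hα)

open scoped Classical in
theorem multiset_prod (R : Multiset QSeries) :
    ∃ (ν : ℚ) (P : Polynomial ℂ), P ≠ 0 ∧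
      P.natDegree = (R.filter fun α => (h : WithTop ℚ) ≤ (α - c).orderTop).card ∧
      HasInitialForm c h
        (fun ξ => (R.map fun α => Polynomial.X - Polynomial.C α).prod.eval ξ)
        (fun ξ => (Polynomial.derivative
          (R.map fun α => Polynomial.X - Polynomial.C α).prod).eval ξ) ν P := by
  induction R using Multiset.induction with
  | empty =>
    refine ⟨0, 1, one_ne_zero, by simp, fun ξ a _ => ⟨?_, ?_⟩⟩
    · simpa using hasLeadingTerm_mono 0 1
    · simpa using hasLeadingTerm_zero (-h)
  | cons α R ih =>
    obtain ⟨ν, P, hP, hd, hR⟩ := ih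
    have key : ∀ (ν' : ℚ) (P' : Polynomial ℂ),
        HasInitialForm c h (fun ξ => ξ - α) (fun _ => 1) ν' P' → HasInitialForm c h
        (fun ξ => ((α ::ₘ R).map fun α => Polynomial.X - Polynomial.C α).prod.eval ξ)
        (fun ξ => (Polynomial.derivative
          ((α ::ₘ R).map fun α => Polynomial.X - Polynomial.C α).prod).eval ξ)
        (ν' + ν) (P' * P) := by
      intro ν' P' h'
      have := h'.mul hR
      intro ξ a hξ
      have := this ξ a hξ
      simpa using this
    by_cases hα : (h : WithTop ℚ) ≤ (α - c).orderTop
    · obtain ⟨b, hb⟩ := exists_climbsOver_iff.2 hα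
      refine ⟨_, _, mul_ne_zero (Polynomial.X_sub_C_ne_zero b) hP, ?_,
        key _ _ (sub_const_of_climbsOver hb)⟩
      rw [Polynomial.natDegree_mul (Polynomial.X_sub_C_ne_zero b) hP, hd,
        Multiset.filter_cons_of_pos (p := fun α => (h : WithTop ℚ) ≤ (α - c).orderTop) _ hα]
      simp [add_comm]
    · obtain ⟨ν', b, hb, hb'⟩ := sub_const_of_lt (not_le.1 hα)
      refine ⟨_, _, mul_ne_zero (Polynomial.C_ne_zero.2 hb) hP, ?_, key _ _ hb'⟩
      rw [Polynomial.natDegree_C_mul hb, hd, Multiset.filter_cons_of_neg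
        (p := fun α => (h : WithTop ℚ) ≤ (α - c).orderTop) _ hα]

end HasInitialForm

open scoped Classical in
/-- The initial form of a germ has as many zeros as the germ has roots which climb. -/
theorem HasRootMultiset.exists_initialForm {F : Series2} {R : Multiset QSeries}
    (hF : HasRootMultiset F R) {c : QSeries} {h : ℚ} (hh : 0 < h) (hc : 0 < c.orderTop) :
    ∃ (ν : ℚ) (P : Polynomial ℂ), P ≠ 0 ∧
      P.natDegree = (R.filter fun α => (h : WithTop ℚ) ≤ (α - c).orderTop).card ∧
      HasInitialForm c h (evalAt F) (evalAt (dx F)) ν P := by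
  obtain ⟨-, k, U, V, hU, hF, hV⟩ := hF
  obtain ⟨ν, P, hP, hd, hR⟩ := HasInitialForm.multiset_prod (c := c) (h := h) R
  have hη := orderTop_mono_one_pos
  -- The x-derivative of the unit has order at least 0 > -h, which agrees with the zero derivative
  -- of a constant initial form.
  have hneg : ∀ {ξ : QSeries}, 0 ≤ ξ.orderTop → HasLeadingTerm ξ (0 - h) 0 := by
    intro ξ hξ
    refine hasLeadingTerm_of_lt (lt_of_lt_of_le ?_ hξ)
    exact_mod_cast (by linarith : 0 - h < 0)
  have h1 : HasInitialForm c h (evalAt U) (evalAt (dx U)) 0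
      (Polynomial.C (constantCoeff U)) := by
    intro ξ a hξ
    have hξ := hξ.orderTop_pos hh hc
    refine ⟨by simpa [evalAt_eq_evalPair] using hasLeadingTerm_evalPair hξ hη U, ?_⟩
    simpa [evalAt_eq_evalPair] using hneg (orderTop_evalPair_nonneg hξ hη (dx U))
  have h2 : HasInitialForm c h (fun _ => mono 1 1 ^ k) (fun _ => 0) k 1 := by
    intro ξ a _
    refine ⟨?_, ?_⟩
    · have := hasLeadingTerm_mono k 1
      simpa [HahnSeries.single_pow] using this
    · simpa using hasLeadingTerm_zero (k - h)
  have h3 := (h2.mul h1).mul hR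
  refine ⟨k + 0 + ν, _, mul_ne_zero (mul_ne_zero one_ne_zero (Polynomial.C_ne_zero.2 hU)) hP, ?_, ?_⟩
  · rw [one_mul, Polynomial.natDegree_C_mul hU, hd]
  · intro ξ a hξ
    obtain ⟨h4, h5⟩ := h3 ξ a hξ
    have hξ := hξ.orderTop_pos hh hc
    have hX : evalAt (X 1) ξ = mono 1 1 := by rw [evalAt_eq_evalPair, evalPair_X_one hξ hη]
    have hV0 := hV ξ hξ 0
    have hV1 := hV ξ hξ 1
    simp only [Function.iterate_zero, Function.iterate_one, id] at hV0 hV1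
    have e1 : evalAt F ξ = mono 1 1 ^ k * evalAt U ξ * evalAt V ξ := by
      rw [hF]
      simp only [← evalAtHom_apply hξ, map_mul, map_pow]
      rw [evalAtHom_apply hξ (X 1), hX]
    have e2 : evalAt (dx F) ξ = mono 1 1 ^ k * evalAt (dx U) ξ * evalAt V ξ +
        mono 1 1 ^ k * evalAt U ξ * evalAt (dx V) ξ := by
      have : dx F = X 1 ^ k * dx U * V + X 1 ^ k * U * dx V := by
        have hXk : dx (X 1 ^ k) = 0 := by
          simp [dx, Derivation.leibniz_pow, pderiv_X_of_ne]
        rw [hF]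
        simp only [dx, Derivation.leibniz, smul_eq_mul] at hXk ⊢
        rw [hXk]
        ring
      rw [this]
      simp only [← evalAtHom_apply hξ, map_mul, map_pow, map_add]
      rw [evalAtHom_apply hξ (X 1), hX]
    rw [e1, e2, hV0, hV1]
    refine ⟨h4, ?_⟩
    simpa using h5

/-! ### Zeros of sums of simple fractions -/

theorem finsum_rootMultiplicity_eq_natDegree {P : Polynomial ℂ} (hP : P ≠ 0) :
    ∑ᶠ z ∈ {z | P.IsRoot z}, P.rootMultiplicity z = P.natDegree := by
  classical
  have h : {z | P.IsRoot z} = (P.roots.toFinset : Set ℂ) := by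
    ext z; simp [hP]
  rw [h, finsum_mem_coe_finset, (IsAlgClosed.splits P).natDegree_eq_card_roots,
    ← Multiset.toFinset_sum_count_eq]
  exact Finset.sum_congr rfl fun z _ => (Polynomial.count_roots P).symm

/-- Over the common denominator, the numerator has leading coefficient ∑ d_c in degree |S| - 1. At
each c it takes a nonzero multiple of d_c as value, so nothing cancels and it agrees with `num` up
to a unit. -/
theorem natDegree_num_sum_simple_fractions (S : Finset ℂ) (hS : S.Nonempty) (d : ℂ → ℂ)
    (hd : ∀ c ∈ S, d c ≠ 0) (hsum : ∑ c ∈ S, d c ≠ 0) :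
    (∑ c ∈ S, RatFunc.C (d c) / (RatFunc.X - RatFunc.C c)).num ≠ 0 ∧
    (∑ c ∈ S, RatFunc.C (d c) / (RatFunc.X - RatFunc.C c)).num.natDegree + 1 = S.card := by
  classical
  set r := ∑ c ∈ S, RatFunc.C (d c) / (RatFunc.X - RatFunc.C c) with hr
  set N : Polynomial ℂ := ∑ c ∈ S, Polynomial.C (d c) *
    ∏ e ∈ S.erase c, (Polynomial.X - Polynomial.C e) with hN
  set Q : Polynomial ℂ := ∏ c ∈ S, (Polynomial.X - Polynomial.C c) with hQ
  have hQ0 : Q ≠ 0 := Finset.prod_ne_zero_iff.2 fun c _ => Polynomial.X_sub_C_ne_zero c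
  have hX : ∀ c : ℂ, algebraMap (Polynomial ℂ) (RatFunc ℂ) (Polynomial.X - Polynomial.C c) =
      RatFunc.X - RatFunc.C c := by
    intro c; simp
  have hX0 : ∀ c : ℂ, (RatFunc.X - RatFunc.C c : RatFunc ℂ) ≠ 0 := by
    intro c
    rw [← hX]
    exact (map_ne_zero_iff _ (RatFunc.algebraMap_injective ℂ)).2 (Polynomial.X_sub_C_ne_zero c)
  have hrQ : r * algebraMap _ _ Q = algebraMap _ _ N := by
    rw [hr, hN, Finset.sum_mul, map_sum]
    refine Finset.sum_congr rfl fun c hc => ?_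
    rw [hQ, ← Finset.mul_prod_erase S _ hc, map_mul, map_mul, hX, RatFunc.algebraMap_C]
    field_simp [hX0 c]
  have hdeg : ∀ c ∈ S, (∏ e ∈ S.erase c, (Polynomial.X - Polynomial.C e)).natDegree =
      S.card - 1 := by
    intro c hc
    rw [Polynomial.natDegree_prod_of_monic _ _ fun e _ => Polynomial.monic_X_sub_C e]
    simp [Finset.card_erase_of_mem hc]
  have hcoeff : N.coeff (S.card - 1) = ∑ c ∈ S, d c := by
    rw [hN, Polynomial.finsetSum_coeff]
    refine Finset.sum_congr rfl fun c hc => ?_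
    have hm : (∏ e ∈ S.erase c, (Polynomial.X - Polynomial.C e)).Monic :=
      Polynomial.monic_prod_of_monic _ _ fun e _ => Polynomial.monic_X_sub_C e
    rw [Polynomial.coeff_C_mul, ← hdeg c hc, hm.coeff_natDegree, mul_one]
  have hNdeg : N.natDegree = S.card - 1 := by
    refine le_antisymm ?_ (Polynomial.le_natDegree_of_ne_zero (by rwa [hcoeff]))
    refine Polynomial.natDegree_sum_le_of_forall_le _ _ fun c hc => ?_
    exact (Polynomial.natDegree_C_mul_le _ _).trans (hdeg c hc).le
  have hN0 : N ≠ 0 := by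
    intro h
    rw [h, Polynomial.coeff_zero] at hcoeff
    exact hsum hcoeff.symm
  have hcop : IsCoprime N Q := by
    refine IsCoprime.prod_right fun c hc => ?_
    refine ((Polynomial.irreducible_X_sub_C c).coprime_iff_not_dvd.2 ?_).symm
    rw [Polynomial.dvd_iff_isRoot, Polynomial.IsRoot.def, hN, Polynomial.eval_finsetSum,
      Finset.sum_eq_single c]
    · rw [Polynomial.eval_mul, Polynomial.eval_C, Polynomial.eval_prod]
      refine mul_ne_zero (hd c hc) (Finset.prod_ne_zero_iff.2 fun e he => ?_)
      simpa [sub_eq_zero] using (Finset.ne_of_mem_erase he).symm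
    · intro b _ hb
      rw [Polynomial.eval_mul, Polynomial.eval_prod,
        Finset.prod_eq_zero (Finset.mem_erase.2 ⟨hb.symm, hc⟩) (by simp), mul_zero]
    · exact fun h => absurd hc h
  have hpoly : r.num * Q = N * r.denom := by
    apply RatFunc.algebraMap_injective ℂ
    have h0 := (map_ne_zero_iff _ (RatFunc.algebraMap_injective ℂ)).2 r.denom_ne_zero
    have h1 := RatFunc.num_div_denom r
    rw [div_eq_iff h0] at h1
    rw [map_mul, map_mul, h1, ← hrQ]
    ring
  have h1 : r.num ∣ N := (RatFunc.isCoprime_num_denom r).dvd_of_dvd_mul_right ⟨Q, hpoly.symm⟩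
  have h2 : N ∣ r.num := hcop.dvd_of_dvd_mul_right ⟨r.denom, hpoly⟩
  have hnum : r.num ≠ 0 := fun h => hN0 (zero_dvd_iff.1 (h ▸ h1))
  refine ⟨hnum, ?_⟩
  have h3 := Polynomial.natDegree_le_of_dvd h1 hN0
  have h4 := Polynomial.natDegree_le_of_dvd h2 hnum
  have := hS.card_pos
  omega

/-! ### The Jacobian along an arc -/

/-- In the chain rule for f and g the terms f_x g_x · (y d/dy ξ) cancel. -/
theorem evalAt_jacobian_mul (f g : Series2) {ξ : QSeries} (hξ : 0 < ξ.orderTop) :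
    evalAt (jacobian f g) ξ * mono 1 1 =
      euler (evalAt f ξ) * evalAt (dx g) ξ - euler (evalAt g ξ) * evalAt (dx f) ξ := by
  rw [euler_evalAt hξ, euler_evalAt hξ, jacobian]
  simp only [← evalAtHom_apply hξ, map_sub, map_mul]
  ring

/-- The Euler derivation multiplies a leading coefficient by its exponent, which is how ν_f and ν_g
enter; the shift by -1 divides out the factor y of `evalAt_jacobian_mul`. -/
theorem HasLeadingTerm.evalAt_jacobian {f g : Series2} {c : QSeries} {h νf νg : ℚ}
    {P Q : Polynomial ℂ} (hf : HasInitialForm c h (evalAt f) (evalAt (dx f)) νf P)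
    (hg : HasInitialForm c h (evalAt g) (evalAt (dx g)) νg Q) {ξ : QSeries} {a : ℂ}
    (hξ : ClimbsOver c h ξ a) (hpos : 0 < ξ.orderTop) :
    HasLeadingTerm (evalAt (jacobian f g) ξ) (νf + νg - h - 1)
      ((νf : ℂ) * P.eval a * Q.derivative.eval a - (νg : ℂ) * Q.eval a * P.derivative.eval a) := by
  obtain ⟨h1, h2⟩ := hf ξ a hξ
  obtain ⟨h3, h4⟩ := hg ξ a hξ
  have h5 := h1.euler.mul h4
  have h6 := h3.euler.mul h2
  rw [show νf + (νg - h) = νf + νg - h by ring] at h5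
  rw [show νg + (νf - h) = νf + νg - h by ring] at h6
  have h7 := (h5.sub h6).mul (hasLeadingTerm_mono (-1) 1)
  rw [← evalAt_jacobian_mul f g hpos, mul_assoc] at h7
  simpa [sub_eq_add_neg] using h7

theorem evalAt_neg (F : Series2) (ξ : QSeries) : evalAt (-F) ξ = -evalAt F ξ :=
  map_neg (evalLinear ξ (mono 1 1)) F

theorem roots_neg (F : Series2) : roots (-F) = roots F := by
  ext ξ; simp [roots, evalAt_neg]

theorem rootMult_neg (F : Series2) (ξ : QSeries) : rootMult (-F) ξ = rootMult F ξ := by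
  have h : ∀ (k : ℕ) (F : Series2), dx^[k] (-F) = -dx^[k] F := by
    intro k
    induction k with
    | zero => intro F; rfl
    | succ k ih => intro F; rw [Function.iterate_succ_apply, Function.iterate_succ_apply,
        dx, map_neg, ih]
  have h' : {k : ℕ | evalAt (dx^[k] (-F)) ξ ≠ 0} = {k : ℕ | evalAt (dx^[k] F) ξ ≠ 0} := by
    ext k; simp [h, evalAt_neg]
  change (⨅ k ∈ {k : ℕ | evalAt (dx^[k] (-F)) ξ ≠ 0}, (k : ℕ∞)) = _
  rw [h']
  rfl

theorem jacobian_swap (f g : Series2) : jacobian g f = -jacobian f g := by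
  simp only [jacobian]; ring

/-! ### Simple roots -/

theorem isArc_zero : IsArc 0 := ⟨1, one_pos, by simp⟩

theorem HasSimpleRoots.ne_zero {F : Series2} (h : HasSimpleRoots F) : F ≠ 0 := by
  rintro rfl
  have h0 : ∀ ξ, evalAt 0 ξ = 0 := fun ξ => map_zero (evalLinear ξ (mono 1 1))
  have hk : ∀ k : ℕ, dx^[k] (0 : Series2) = 0 := by
    intro k
    induction k with
    | zero => rfl
    | succ k ih => rw [Function.iterate_succ_apply, dx, map_zero, ih]
  have h1 := h 0 ⟨isArc_zero, h0 0⟩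
  have h2 : (⨅ k ∈ {k : ℕ | evalAt (dx^[k] (0 : Series2)) 0 ≠ 0}, (k : ℕ∞)) = 1 := h1
  simp [hk, h0] at h2

/-- If f and f_x both vanished along α, so would f g and its x-derivative, giving multiplicity at
least 2. -/
theorem HasSimpleRoots.evalAt_dx_ne_zero {f g : Series2} (h : HasSimpleRoots (f * g))
    {α : QSeries} (hα : α ∈ roots f) : evalAt (dx f) α ≠ 0 := by
  intro hcon
  have hpos := hα.1.orderTop_pos
  have h0 : evalAt (f * g) α = 0 := by
    rw [← evalAtHom_apply hpos, map_mul, evalAtHom_apply, hα.2, zero_mul]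
  have h1 : evalAt (dx (f * g)) α = 0 := by
    rw [dx, Derivation.leibniz, ← evalAtHom_apply hpos, map_add, smul_eq_mul, smul_eq_mul,
      map_mul, map_mul, evalAtHom_apply, hα.2, evalAtHom_apply hpos (pderiv ℂ 0 f)]
    rw [dx] at hcon
    rw [hcon, zero_mul, mul_zero, add_zero]
  have h2 : (⨅ k ∈ {k : ℕ | evalAt (dx^[k] (f * g)) α ≠ 0}, (k : ℕ∞)) = 1 :=
    h α ⟨hα.1, h0⟩
  have h3 : (2 : ℕ∞) ≤ ⨅ k ∈ {k : ℕ | evalAt (dx^[k] (f * g)) α ≠ 0}, (k : ℕ∞) := by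
    refine le_iInf₂ fun k hk => ?_
    rcases k with _ | _ | k
    · exact absurd h0 hk
    · exact absurd h1 hk
    · exact_mod_cast (by omega : 2 ≤ k + 1 + 1)
  rw [h2] at h3
  exact absurd h3 (by norm_num)

/-- Needed because bimultiplicities count sets of roots, while degrees of initial forms count with
multiplicity. -/
theorem HasRootMultiset.nodup {f g : Series2} {R : Multiset QSeries} (hR : HasRootMultiset f R)
    (h : HasSimpleRoots (f * g)) : R.Nodup := by
  classical
  rw [Multiset.nodup_iff_count_le_one]
  intro α
  by_cases hα : α ∈ R
  · have hα' := hR.mem_roots_iff.2 hα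
    have h1 := hR.rootMult_eq hα'.1.orderTop_pos
    have h2 : rootMult f α ≤ (1 : ℕ) := iInf₂_le 1 (h.evalAt_dx_ne_zero hα')
    rw [h1] at h2
    exact_mod_cast h2
  · rw [Multiset.count_eq_zero_of_notMem hα]; exact zero_le_one

theorem exists_eval_ne_zero {P : Polynomial ℂ} (hP : P ≠ 0) : ∃ a, P.eval a ≠ 0 := by
  by_contra! h
  exact hP (Polynomial.funext fun a => by simpa using h a)

/-! ### Trunks and bars -/

theorem IsTrunk.subset {Λ T : Set QSeries} (hT : IsTrunk Λ T) : T ⊆ Λ := by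
  induction hT with
  | main _ => exact subset_rfl
  | grow _ _ _ ih => exact fun η hη => ih hη.1

theorem min_contact_le (μ η θ : QSeries) : min (contact μ η) (contact η θ) ≤ contact μ θ := by
  have : μ - θ = (μ - η) + (η - θ) := by ring
  rw [contact, contact, contact, this]
  exact HahnSeries.min_orderTop_le_orderTop_add

theorem contact_comm (μ η : QSeries) : contact μ η = contact η μ := by
  rw [contact, contact, ← HahnSeries.orderTop_neg, neg_sub]

/-- A root whose contact with a member of a trunk is at least the height of the bar on top of
the trunk belongs to the trunk. -/
theorem IsTrunk.mem_of_le_contact {Λ T : Set QSeries} (hT : IsTrunk Λ T) {h : WithTop ℚ}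
    (hh : IsTopHeight T h) {μ η : QSeries} (hμ : μ ∈ T) (hη : η ∈ Λ) (hle : h ≤ contact μ η) :
    η ∈ T := by
  induction hT generalizing h μ with
  | main _ => exact hη
  | @grow T' h' μ₀ _ hh' _ ih =>
    obtain ⟨μ₁, hμ₁, μ₂, hμ₂, he⟩ := hh.1
    -- Heights increase strictly along the tree: h is the contact of two members of one class modulo
    -- contact > h'.
    have hlt : (h' : WithTop ℚ) < h := by
      rw [he]
      refine lt_of_lt_of_le (lt_min ?_ hμ₂.2) (min_contact_le μ₁ μ₀ μ₂)
      rw [contact_comm]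
      exact hμ₁.2
    have hlt' := hlt.trans_le hle
    exact ⟨ih hh' hμ.1 hlt'.le, lt_of_lt_of_le (lt_min hμ.2 hlt') (min_contact_le μ₀ μ η)⟩

namespace Bar

variable {f g : Series2} (B : Bar f g)

theorem isArc_of_mem_trunk {μ : QSeries} (hμ : μ ∈ B.trunk) : IsArc μ := by
  rcases B.isTrunk.subset hμ with h | h <;> exact h.1

theorem height_pos : 0 < B.height := by
  obtain ⟨μ, hμ, η, hη, he⟩ := B.isTopHeight.1
  have : (0 : WithTop ℚ) < B.height := by
    rw [he]
    exact lt_of_lt_of_le (lt_min (B.isArc_of_mem_trunk hμ).orderTop_pos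
      (B.isArc_of_mem_trunk hη).orderTop_pos) HahnSeries.min_orderTop_le_orderTop_sub
  exact_mod_cast this

theorem orderTop_base_pos : 0 < B.base.orderTop := by
  obtain ⟨μ, hμ⟩ := B.isTrunk.nonempty
  refine lt_of_lt_of_le (B.isArc_of_mem_trunk hμ).orderTop_pos ?_
  rw [B.base_eq hμ, HahnSeries.le_orderTop_iff_forall]
  intro e he
  simp [HahnSeries.coeff_truncLT, HahnSeries.coeff_eq_zero_of_lt_orderTop he]

theorem height_le_of_mem_trunk {μ : QSeries} (hμ : μ ∈ B.trunk) :
    (B.height : WithTop ℚ) ≤ (μ - B.base).orderTop := by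
  rw [B.base_eq hμ, HahnSeries.le_orderTop_iff_forall]
  intro e he
  simp [HahnSeries.coeff_truncLT, WithTop.coe_lt_coe.1 he]

/-- By the ultrametric inequality, the roots climbing over B are exactly those of its trunk; degrees
of initial forms thus become bimultiplicities. -/
theorem mem_trunk_iff {η : QSeries} (hη : η ∈ roots f ∪ roots g) :
    η ∈ B.trunk ↔ (B.height : WithTop ℚ) ≤ (η - B.base).orderTop := by
  refine ⟨B.height_le_of_mem_trunk, fun h => ?_⟩
  obtain ⟨μ, hμ⟩ := B.isTrunk.nonempty
  refine B.isTrunk.mem_of_le_contact B.isTopHeight hμ hη ?_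
  have : μ - η = (μ - B.base) - (η - B.base) := by ring
  rw [contact, this]
  exact le_trans (le_min (B.height_le_of_mem_trunk hμ) h) HahnSeries.min_orderTop_le_orderTop_sub

theorem climbs_iff (ξ : QSeries) :
    B.Climbs ξ ↔ (B.height : WithTop ℚ) ≤ (ξ - B.base).orderTop := exists_climbsOver_iff

theorem nu_eq {F : Series2} {v : QSeries → QSeries} {ν : ℚ} {P : Polynomial ℂ} (hP : P ≠ 0)
    (hF : HasInitialForm B.base B.height (evalAt F) v ν P) : B.nu F = ν := by
  have hev : ∀ᶠ z : ℂ in Filter.cofinite,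
      (evalAt F (B.base + mono B.height z)).orderTop = ν := by
    have hfin : {z : ℂ | P.IsRoot z}.Finite := P.finite_setOfPred_isRoot hP
    filter_upwards [hfin.compl_mem_cofinite] with z hz
    exact (hF _ z (by simp [ClimbsOver])).1.orderTop_eq hz
  have hex : ∃ e : ℚ, ∀ᶠ z : ℂ in Filter.cofinite,
      (evalAt F (B.base + mono B.height z)).orderTop = e := ⟨ν, hev⟩
  rw [nu, dif_pos hex]
  -- Two cofinite conditions on the infinite set ℂ hold together at some z, so the chosen generic
  -- order is ν.
  obtain ⟨z, h1, h2⟩ := (hex.choose_spec.and hev).exists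
  rw [h1] at h2
  exact_mod_cast h2

open scoped Classical in
theorem filter_climbs_eq_zero {F : Series2} {R : Multiset QSeries} (hR : HasRootMultiset F R)
    (hF : roots F ⊆ roots f ∪ roots g) (h : (B.trunk ∩ roots F).encard = 0) :
    R.filter (fun α => (B.height : WithTop ℚ) ≤ (α - B.base).orderTop) = 0 := by
  rw [Multiset.filter_eq_nil]
  intro α hα hle
  have hα' := hR.mem_roots_iff.2 hα
  rw [Set.encard_eq_zero] at h
  exact Set.eq_empty_iff_forall_notMem.1 h α ⟨(B.mem_trunk_iff (hF hα')).2 hle, hα'⟩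

open scoped Classical in
theorem card_filter_climbs {F : Series2} {R : Multiset QSeries} (hR : HasRootMultiset F R)
    (hF : roots F ⊆ roots f ∪ roots g) (hnd : R.Nodup) :
    (B.trunk ∩ roots F).encard =
      ((R.filter fun α => (B.height : WithTop ℚ) ≤ (α - B.base).orderTop).card : ℕ∞) := by
  have h : B.trunk ∩ roots F =
      ((R.filter fun α => (B.height : WithTop ℚ) ≤ (α - B.base).orderTop).toFinset :
        Set QSeries) := by
    ext α
    rw [Finset.mem_coe, Multiset.mem_toFinset, Multiset.mem_filter, ← hR.mem_roots_iff]
    constructor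
    · rintro ⟨h1, h2⟩
      exact ⟨h2, (B.mem_trunk_iff (hF h2)).1 h1⟩
    · rintro ⟨h1, h2⟩
      exact ⟨(B.mem_trunk_iff (hF h1)).2 h2, h1⟩
  rw [h, Set.encard_coe_eq_coe_finsetCard, Multiset.toFinset_card_of_nodup (hnd.filter _)]

/-- Over a bar on top of a trunk consisting of `s` roots of `f` and no roots of `g`, on which
`g` does not have order zero, there climb exactly `s - 1` polar roots. -/
theorem polarCount_add_one (hsimple : HasSimpleRoots (f * g)) {s : ℕ}
    (hs : HasBimult f g B.trunk s 0) (hν : B.nu g ≠ 0) : B.polarCount + 1 = (s : ℕ∞) := by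
  classical
  have hh := B.height_pos
  have hc := B.orderTop_base_pos
  obtain ⟨Rf, hRf⟩ := exists_hasRootMultiset (left_ne_zero_of_mul hsimple.ne_zero)
  obtain ⟨Rg, hRg⟩ := exists_hasRootMultiset (right_ne_zero_of_mul hsimple.ne_zero)
  obtain ⟨νf, P, hP, hPd, hf⟩ := hRf.exists_initialForm hh hc
  obtain ⟨νg, Q, hQ, hQd, hg⟩ := hRg.exists_initialForm hh hc
  have hPs : P.natDegree = s := by
    have h1 := B.card_filter_climbs hRf Set.subset_union_left (hRf.nodup hsimple)
    rw [hs.1, ← hPd] at h1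
    exact_mod_cast h1.symm
  have hQ0 : Q.natDegree = 0 := by
    rw [hQd, B.filter_climbs_eq_zero hRg Set.subset_union_right (by simpa using hs.2),
      Multiset.card_zero]
  obtain ⟨b, rfl⟩ := Polynomial.natDegree_eq_zero.1 hQ0
  have hb : b ≠ 0 := Polynomial.C_ne_zero.1 hQ
  rw [B.nu_eq hQ hg] at hν
  have hs0 : s ≠ 0 := by
    rintro rfl
    obtain ⟨μ, hμ⟩ := B.isTrunk.nonempty
    have h1 := hs.1
    have h2 := hs.2
    simp only [Nat.cast_zero, Set.encard_eq_zero, Set.eq_empty_iff_forall_notMem] at h1 h2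
    rcases B.isTrunk.subset hμ with h | h
    · exact h1 μ ⟨hμ, h⟩
    · exact h2 μ ⟨hμ, h⟩
  have hP' : P.derivative ≠ 0 := by
    intro h
    exact hs0 (hPs ▸ Polynomial.derivative_eq_zero.1 h)
  set κ : ℂ := -(νg * b) with hκ
  have hκ0 : κ ≠ 0 := neg_ne_zero.2 (mul_ne_zero (by exact_mod_cast hν) hb)
  have hJ : ∀ ξ a, ClimbsOver B.base B.height ξ a →
      HasLeadingTerm (evalAt (jacobian f g) ξ) (νf + νg - B.height - 1)
        (κ * P.derivative.eval a) := by
    intro ξ a hξ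
    have := HasLeadingTerm.evalAt_jacobian hf hg hξ (hξ.orderTop_pos hh hc)
    simpa [hκ] using this
  have hclimb : ∀ a, ClimbsOver B.base B.height (B.base + mono B.height a) a := by
    intro a; simp [ClimbsOver]
  have hJ0 : jacobian f g ≠ 0 := by
    intro h0
    obtain ⟨a, ha⟩ := exists_eval_ne_zero hP'
    refine (hJ _ a (hclimb a)).ne_zero (mul_ne_zero hκ0 ha) ?_
    rw [h0]
    exact map_zero (evalLinear _ (mono 1 1))
  obtain ⟨RJ, hRJ⟩ := exists_hasRootMultiset hJ0
  obtain ⟨νJ, S, hS, hSd, hJ'⟩ := hRJ.exists_initialForm hh hc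
  -- J has an initial form S from its own roots and an expansion from f and g. The exponents agree
  -- at a point where neither coefficient vanishes, and then the coefficients agree everywhere.
  have hSP : S = Polynomial.C κ * P.derivative := by
    have hν' : νf + νg - B.height - 1 = νJ := by
      obtain ⟨a, ha⟩ := exists_eval_ne_zero (mul_ne_zero hP' hS)
      rw [Polynomial.eval_mul] at ha
      have h1 := (hJ _ a (hclimb a)).orderTop_eq (mul_ne_zero hκ0 (left_ne_zero_of_mul ha))
      have h2 := (hJ' _ a (hclimb a)).1.orderTop_eq (right_ne_zero_of_mul ha)
      rw [h1] at h2
      exact_mod_cast h2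
    refine Polynomial.funext fun a => ?_
    have h1 := (hJ _ a (hclimb a)).coeff
    have h2 := (hJ' _ a (hclimb a)).1.coeff
    rw [hν', h2] at h1
    simpa using h1
  have hcard : (RJ.filter fun α => (B.height : WithTop ℚ) ≤ (α - B.base).orderTop).card + 1
      = s := by
    rw [← hSd, hSP, Polynomial.natDegree_C_mul hκ0, Polynomial.natDegree_derivative, hPs]
    omega
  have hpolar : ∀ γ ∈ RJ, B.Climbs γ → IsPolarRoot f g γ := by
    intro γ hγ hcl
    have hγ' := hRJ.mem_roots_iff.2 hγ
    have hpos := hγ'.1.orderTop_pos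
    obtain ⟨a, ha⟩ := hcl
    have hgγ := (hg γ a ha).1
    rw [Polynomial.eval_C] at hgγ
    -- If f(γ) = 0, the Jacobian identity reduces to (y d/dy g(γ)) f_x(γ) = 0. The first factor is
    -- nonzero since ν_g b ≠ 0, the second by simplicity of the roots.
    refine ⟨hγ', mul_ne_zero (fun h0 => ?_) (hgγ.ne_zero hb)⟩
    have h1 := hsimple.evalAt_dx_ne_zero ⟨hγ'.1, h0⟩
    have h2 := hgγ.euler.ne_zero (mul_ne_zero (by exact_mod_cast hν) hb)
    have h3 := evalAt_jacobian_mul f g hpos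
    rw [hγ'.2, h0, euler_zero, zero_mul, zero_mul, zero_sub, eq_comm, neg_eq_zero] at h3
    exact mul_ne_zero h2 h1 h3
  have hset : {w : QSeries × ℕ | IsPolarRoot f g w.1 ∧ B.Climbs w.1 ∧
      (w.2 : ℕ∞) < rootMult (jacobian f g) w.1} =
      ((RJ.filter fun α => (B.height : WithTop ℚ) ≤ (α - B.base).orderTop).toEnumFinset :
        Set (QSeries × ℕ)) := by
    ext ⟨γ, i⟩
    simp only [Set.mem_ofPred_eq, Finset.mem_coe, Multiset.mem_toEnumFinset,
      Multiset.count_filter, B.climbs_iff]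
    constructor
    · rintro ⟨h1, h2, h3⟩
      rw [if_pos h2]
      rw [hRJ.rootMult_eq h1.1.1.orderTop_pos] at h3
      exact_mod_cast h3
    · intro h
      split_ifs at h with h2
      · have hγ : γ ∈ RJ := Multiset.count_pos.1 (by omega)
        refine ⟨hpolar γ hγ ((B.climbs_iff γ).2 h2), h2, ?_⟩
        rw [hRJ.rootMult_eq (hRJ.1 γ hγ).orderTop_pos]
        exact_mod_cast h
      · omega
  rw [polarCount, hset, Set.encard_coe_eq_coe_finsetCard, Multiset.card_toEnumFinset]
  exact_mod_cast hcard

/-! ### The rational function of a bar -/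

/-- All Δ_B(z_k) are one nonzero constant times positive integers, so neither they nor their sum
vanish. The form with κ and w serves both kinds of trunk. -/
theorem m_add_one_eq (hfin : B.points.Finite) {κ : ℚ} (hκ : κ ≠ 0) {w : ℂ → ℕ}
    (hw : ∀ c ∈ B.points, w c ≠ 0) (hdelta : ∀ c ∈ B.points, B.delta c = κ * w c) :
    B.IsPurelyNonCollinear ∧ B.m + 1 = B.n := by
  have hne : ∀ c ∈ B.points, B.delta c ≠ 0 := by
    intro c hc
    rw [hdelta c hc]
    exact mul_ne_zero hκ (by exact_mod_cast hw c hc)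
  have hN : B.nonCollinearPoints = B.points := by
    ext c; exact ⟨fun h => h.1, fun h => ⟨h, hne c h⟩⟩
  obtain ⟨μ, hμ⟩ := B.isTrunk.nonempty
  have hmem : μ.coeff B.height ∈ B.points := ⟨μ, hμ, rfl⟩
  refine ⟨⟨?_, ?_⟩, ?_⟩
  · rw [Set.eq_empty_iff_forall_notMem]
    exact fun c hc => hne c hc.1 hc.2
  · rw [hN]
    exact Set.Nonempty.ne_empty ⟨_, hmem⟩
  · have hS : (hfin.toFinset).Nonempty := ⟨_, hfin.mem_toFinset.2 hmem⟩
    have hrat : B.ratFunc = ∑ c ∈ hfin.toFinset,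
        RatFunc.C (B.delta c : ℂ) / (RatFunc.X - RatFunc.C c) := by
      rw [ratFunc, finsum_mem_eq_finite_toFinset_sum _ hfin]
    have hsum : ∑ c ∈ hfin.toFinset, (B.delta c : ℂ) ≠ 0 := by
      have h1 : ∑ c ∈ hfin.toFinset, B.delta c = κ * (∑ c ∈ hfin.toFinset, w c : ℕ) := by
        rw [Nat.cast_sum, Finset.mul_sum]
        exact Finset.sum_congr rfl fun c hc => hdelta c (hfin.mem_toFinset.1 hc)
      rw [← Rat.cast_sum, h1]
      have h2 : (∑ c ∈ hfin.toFinset, w c) ≠ 0 := by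
        refine (Finset.sum_pos (fun c hc => ?_) hS).ne'
        exact Nat.pos_of_ne_zero (hw c (hfin.mem_toFinset.1 hc))
      exact_mod_cast mul_ne_zero hκ (by exact_mod_cast h2)
    obtain ⟨h1, h2⟩ := natDegree_num_sum_simple_fractions hfin.toFinset hS
      (fun c => (B.delta c : ℂ))
      (fun c hc => by exact_mod_cast hne c (hfin.mem_toFinset.1 hc)) hsum
    rw [← hrat] at h1 h2
    rw [m, n, hN, Set.ncard_eq_toFinset_card _ hfin, ← h2]
    congr 1
    exact finsum_rootMultiplicity_eq_natDegree h1

theorem finite_points (h : B.trunk.Finite) : B.points.Finite := by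
  refine (h.image fun μ => μ.coeff B.height).subset fun c hc => ?_
  obtain ⟨μ, hμ, hc⟩ := hc
  exact (Set.mem_image _ _ _).2 ⟨μ, hμ, hc⟩

theorem finite_trunk {s t : ℕ} (h : HasBimult f g B.trunk s t) : B.trunk.Finite := by
  have h1 : B.trunk = (B.trunk ∩ roots f) ∪ (B.trunk ∩ roots g) := by
    rw [← Set.inter_union_distrib_left, Set.inter_eq_left.2 B.isTrunk.subset]
  rw [h1]
  exact (Set.finite_of_encard_eq_coe h.1).union (Set.finite_of_encard_eq_coe h.2)

theorem ncard_trunkAt_ne_zero (h : B.trunk.Finite) {F : Series2} (hF : B.trunk ⊆ roots F) {c : ℂ}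
    (hc : c ∈ B.points) : (B.trunkAt c ∩ roots F).ncard ≠ 0 := by
  obtain ⟨μ, hμ⟩ := hc
  have hne : (B.trunkAt c ∩ roots F).Nonempty := ⟨μ, hμ, hF hμ.1⟩
  exact ((Set.ncard_pos (h.subset fun η hη => hη.1.1)).2 hne).ne'

theorem ncard_trunkAt_eq_zero {F : Series2} (hF : (B.trunk ∩ roots F).encard = 0) (c : ℂ) :
    (B.trunkAt c ∩ roots F).ncard = 0 := by
  rw [Set.encard_eq_zero] at hF
  have : B.trunkAt c ∩ roots F = ∅ :=
    Set.subset_empty_iff.1 fun η hη => hF ▸ (⟨hη.1.1, hη.2⟩ : η ∈ B.trunk ∩ roots F)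
  rw [this, Set.ncard_empty]

theorem trunk_subset_left (h : (B.trunk ∩ roots g).encard = 0) : B.trunk ⊆ roots f := by
  rw [Set.encard_eq_zero] at h
  exact fun μ hμ => (B.isTrunk.subset hμ).resolve_right fun h' =>
    Set.eq_empty_iff_forall_notMem.1 h μ ⟨hμ, h'⟩

theorem trunk_subset_right (h : (B.trunk ∩ roots f).encard = 0) : B.trunk ⊆ roots g := by
  rw [Set.encard_eq_zero] at h
  exact fun μ hμ => (B.isTrunk.subset hμ).resolve_left fun h' =>
    Set.eq_empty_iff_forall_notMem.1 h μ ⟨hμ, h'⟩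

/-- The same bar, in the tree model of `(g, f)`. -/
def swap : Bar g f where
  trunk := B.trunk
  isTrunk := Set.union_comm (roots f) (roots g) ▸ B.isTrunk
  height := B.height
  isTopHeight := B.isTopHeight

/-- Interchanging f and g only changes the sign of the Jacobian. -/
theorem swap_polarCount : B.swap.polarCount = B.polarCount := by
  have h : ∀ w : QSeries × ℕ, (IsPolarRoot g f w.1 ∧ B.swap.Climbs w.1 ∧
      (w.2 : ℕ∞) < rootMult (jacobian g f) w.1) ↔ (IsPolarRoot f g w.1 ∧ B.Climbs w.1 ∧
      (w.2 : ℕ∞) < rootMult (jacobian f g) w.1) := by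
    intro w
    rw [IsPolarRoot, IsPolarRoot, jacobian_swap, roots_neg, rootMult_neg, mul_comm]
    exact Iff.rfl
  rw [polarCount, polarCount]
  simp only [h]

end Bar

end PolarTree

theorem mainTheorem10 (f g : PolarTree.Series2)
    (hf : PolarTree.IsConvergent f) (hg : PolarTree.IsConvergent g)
    (hsimple : PolarTree.HasSimpleRoots (f * g)) (B : PolarTree.Bar f g) :
    (∀ s : ℕ, PolarTree.HasBimult f g B.trunk s 0 → B.nu g ≠ 0 →
      B.IsPurelyNonCollinear ∧ B.m + 1 = B.n ∧ B.polarCount + 1 = (s : ℕ∞)) ∧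
    (∀ t : ℕ, PolarTree.HasBimult f g B.trunk 0 t → B.nu f ≠ 0 →
      B.IsPurelyNonCollinear ∧ B.m + 1 = B.n ∧ B.polarCount + 1 = (t : ℕ∞)) := by
  refine ⟨fun s hs hν => ?_, fun t ht hν => ?_⟩
  · have hfin := B.finite_trunk hs
    have h0 : (B.trunk ∩ PolarTree.roots g).encard = 0 := by simpa using hs.2
    -- With no roots of g in the trunk, every q_k is 0 and Δ_B(z_k) = -ν_g(B) p_k.
    obtain ⟨h1, h2⟩ := B.m_add_one_eq (B.finite_points hfin) (κ := -B.nu g) (w := B.p)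
      (neg_ne_zero.2 hν) (fun c hc => B.ncard_trunkAt_ne_zero hfin (B.trunk_subset_left h0) hc)
      (fun c _ => by
        have hq : B.q c = 0 := B.ncard_trunkAt_eq_zero h0 c
        simp [PolarTree.Bar.delta, Matrix.det_fin_two, hq, mul_comm])
    exact ⟨h1, h2, B.polarCount_add_one hsimple hs hν⟩
  · have hfin := B.finite_trunk ht
    have h0 : (B.trunk ∩ PolarTree.roots f).encard = 0 := by simpa using ht.1
    obtain ⟨h1, h2⟩ := B.m_add_one_eq (B.finite_points hfin) (κ := B.nu f) (w := B.q)
      hν (fun c hc => B.ncard_trunkAt_ne_zero hfin (B.trunk_subset_right h0) hc)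
      (fun c _ => by
        have hp : B.p c = 0 := B.ncard_trunkAt_eq_zero h0 c
        simp [PolarTree.Bar.delta, Matrix.det_fin_two, hp])
    refine ⟨h1, h2, ?_⟩
    rw [← B.swap_polarCount]
    exact B.swap.polarCount_add_one (mul_comm f g ▸ hsimple) ht.symm hν
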